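/- \textbf{Lasso guarantees for Gaussian vectors under $\alpha$-mixing.} Let $Z_t=(X_t,Y_t)$, $t=1,2,\dots$, with $X_t\in\mathbb R^p$, $Y_t\in\mathbb R^q$, be a strictly stationary, centered Gaussian process. For $l\ge 0$ let $$\alpha(l)=\sup_{t\ge 1}\ \sup\{|P(A\cap B)-P(A)P(B)| : A\in\sigma(Z_u,\,u\le t),\ B\in\sigma(Z_u,\,u\ge t+l)\},$$ assume that the process is $\alpha$-mixing, i.e. $\alpha(l)\to0$ as $l\to\infty$, and put $S_\alpha(T)=\sum_{l=0}^T\alpha(l)$. Let $\Sigma_X=\mathbb E[X_tX_t']$, $\Sigma_Y=\mathbb E[Y_tY_t']$, assume $\lambda_{\min}(\Sigma_X)>0$, let $\Theta^*=\arg\min_{B\in\mathbb R^{p\times q}}\mathbb E\|Y_t-B'X_t\|_2^2$, and let $s$ be the number of nonzero entries of $\Theta^*$. Let $\mathbf X\in\mathbb R^{T\times p}$ and $\mathbf Y\in\mathbb R^{T\times q}$ have rows $X_1',\dots,X_T'$ and $Y_1',\dots,Y_T'$, and put $\hat\Gamma=\mathbf X'\mathbf X/T$. Below, $\|\cdot\|$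 is the operator norm, $\|\cdot\|_F$ the Frobenius norm and $\Theta^*_{:j}$ the $j$-th column of $\Theta^*$. There are universal constants $c,\tilde c>0$ such that the following holds for all such processes, all $p,q,T$ and all $b>0$. Set $$\eta=\frac{\lambda_{\min}(\Sigma_X)}{108\pi\,S_\alpha(T)\,\lambda_{\max}(\Sigma_X)},\qquad \alpha=\tfrac12\lambda_{\min}(\Sigma_X),\qquad \lambda_T=4QR,$$ $$Q=8\pi\sqrt{\tfrac{b+1}{\tilde c}}\Big(\|\Sigma_X\|\big(1+\max_{1\le j\le q}\|\Theta^*_{:j}\|_2^2\big)+\|\Sigma_Y\|\Big),\qquad R=S_\alpha(T)\sqrt{\frac{\log(pq)}{T}} .$$ If $$T\ \ge\ \max\Big\{\frac{\log p}{c\min\{1,\eta^2\}}\max\{42e,128s\},\ \ \log(pq)\sqrt{\tfrac{b+1}{\tilde c}}\Big\},$$ then with probability at least $1-2\exp\big(-\tfrac c2T\min\{1,\eta^2\}\big)-8\exp(-b\log(pq))$, every lasso estimator $$\hat\Theta\in\arg\min_{B\in\mathbb R^{p\times q}}\Big\{\tfrac1T\|\mathbf Y-\mathbf XB\|_F^2+\lambda_T\sum_{i,j}|B_{ij}|\Big\}$$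 satisfies $$\|\hat\Theta-\Theta^*\|_F\le\frac{4\sqrt s\,\lambda_T}{\alpha},\qquad \frac1T\|\mathbf X(\hat\Theta-\Theta^*)\|_F^2\le\frac{32\lambda_T^2s}{\alpha},\qquad \big\|(\hat\Theta-\Theta^*)'\hat\Gamma(\hat\Theta-\Theta^*)\big\|_F\le\frac{32\lambda_T^2s}{\alpha}.$$ -/

import Mathlib

open MeasureTheory ProbabilityTheory Filter Topology
open scoped Matrix

noncomputable section

namespace MixingLasso

/-! ### Matrix quantities -/

/-- Number of nonzero entries, `‖vec M‖₀`. -/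
def sparsity {m n : ℕ} (M : Matrix (Fin m) (Fin n) ℝ) : ℕ :=
  Set.ncard {ij : Fin m × Fin n | M ij.1 ij.2 ≠ 0}

/-- The entrywise `ℓ₁` norm `‖vec M‖₁`. -/
def vecL1 {m n : ℕ} (M : Matrix (Fin m) (Fin n) ℝ) : ℝ :=
  ∑ i, ∑ j, |M i j|

/-- The Frobenius norm `‖M‖_F = ‖vec M‖₂`. -/
def frob {m n : ℕ} (M : Matrix (Fin m) (Fin n) ℝ) : ℝ :=
  √(∑ i, ∑ j, M i j ^ 2)

/-- The operator norm with respect to the Euclidean norms. -/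
def opNorm {n : ℕ} (M : Matrix (Fin n) (Fin n) ℝ) : ℝ :=
  ‖Matrix.toEuclideanCLM (n := Fin n) (𝕜 := ℝ) M‖

/-- The smallest eigenvalue (used for symmetric matrices). -/
def lambdaMin {n : ℕ} (M : Matrix (Fin n) (Fin n) ℝ) : ℝ := sInf (spectrum ℝ M)

/-- The largest eigenvalue (used for symmetric matrices). -/
def lambdaMax {n : ℕ} (M : Matrix (Fin n) (Fin n) ℝ) : ℝ := sSup (spectrum ℝ M)

/-- The largest squared Euclidean norm of a column. -/
def maxColSq {m n : ℕ} (M : Matrix (Fin m) (Fin n) ℝ) : ℝ := ⨆ j, ∑ i, M i j ^ 2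

/-! ### Stationarity and mixing -/

section Processes

variable {Ω : Type*} [MeasurableSpace Ω]

/-- Strict stationarity: every finite window of the process has the same law as each of its
time shifts. -/
def StrictlyStationary {E : Type*} [MeasurableSpace E] (Z : ℕ → Ω → E) (μ : Measure Ω) : Prop :=
  ∀ m τ n : ℕ,
    IdentDistrib (fun ω (k : Fin (n + 1)) => Z (m + k) ω)
      (fun ω (k : Fin (n + 1)) => Z (m + τ + k) ω) μ μ

/-- The `α` measure of dependence between two sub-σ-algebras,
`sup {|P(A ∩ B) - P(A) P(B)| : A ∈ 𝒜, B ∈ ℬ}`. -/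
def alphaDep (μ : Measure Ω) (𝒜 ℬ : MeasurableSpace Ω) : ℝ :=
  sSup {r : ℝ | ∃ A B : Set Ω, MeasurableSet[𝒜] A ∧ MeasurableSet[ℬ] B ∧
    r = |μ.real (A ∩ B) - μ.real A * μ.real B|}

/-- The σ-algebra generated by `Z u`, `u ≤ t`. -/
abbrev pastSigma {E : Type*} [mE : MeasurableSpace E] (Z : ℕ → Ω → E) (t : ℕ) : MeasurableSpace Ω :=
  ⨆ u : Set.Iic t, mE.comap (Z u)

/-- The σ-algebra generated by `Z u`, `u ≥ t`. -/
abbrev futureSigma {E : Type*} [mE : MeasurableSpace E] (Z : ℕ → Ω → E) (t : ℕ) :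
    MeasurableSpace Ω :=
  ⨆ u : Set.Ici t, mE.comap (Z u)

/-- The `α`-mixing coefficient `α(l)`: the supremum over `t` of the dependence between the process
up to time `t` and the process from time `t + l` on. -/
def alphaCoef {E : Type*} [MeasurableSpace E] (Z : ℕ → Ω → E) (μ : Measure Ω) (l : ℕ) : ℝ :=
  ⨆ t : ℕ, alphaDep μ (pastSigma Z t) (futureSigma Z (t + l))

/-- `α`-mixing: `α(l) → 0` as `l → ∞`. -/
def AlphaMixing {E : Type*} [MeasurableSpace E] (Z : ℕ → Ω → E) (μ : Measure Ω) : Prop :=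
  Tendsto (alphaCoef Z μ) atTop (𝓝 0)

/-- The partial sum `S_α(T) = ∑_{l=0}^T α(l)`. -/
def alphaSum {E : Type*} [MeasurableSpace E] (Z : ℕ → Ω → E) (μ : Measure Ω) (T : ℕ) : ℝ :=
  ∑ l ∈ Finset.range (T + 1), alphaCoef Z μ l

/-! ### Regression and the lasso -/

/-- The second moment matrix `E[V V']` of a random vector (its covariance matrix if centered). -/
def secondMoment {n : ℕ} (V : Ω → Fin n → ℝ) (μ : Measure Ω) : Matrix (Fin n) (Fin n) ℝ :=
  Matrix.of fun i j => ∫ ω, V ω i * V ω j ∂μ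

/-- The population risk `E ‖V - B' U‖₂²` of the linear predictor `B' U` of `V`. -/
def populationRisk {p q : ℕ} (U : Ω → Fin p → ℝ) (V : Ω → Fin q → ℝ) (μ : Measure Ω)
    (B : Matrix (Fin p) (Fin q) ℝ) : ℝ :=
  ∫ ω, ∑ j, (V ω j - (Bᵀ *ᵥ U ω) j) ^ 2 ∂μ

/-- The data matrix whose `T` rows are the first `T` vectors of the process, observed at `ω`. -/
def dataMatrix {n : ℕ} (V : ℕ → Ω → Fin n → ℝ) (T : ℕ) (ω : Ω) : Matrix (Fin T) (Fin n) ℝ :=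
  Matrix.of fun t i => V t ω i

end Processes

/-- The empirical covariance matrix `X'X / T`. -/
def empCov {p T : ℕ} (X : Matrix (Fin T) (Fin p) ℝ) : Matrix (Fin p) (Fin p) ℝ :=
  (1 / (T : ℝ)) • (Xᵀ * X)

/-- The lasso objective `T⁻¹ ‖vec (Y - X B)‖₂² + lam ‖vec B‖₁`. -/
def lassoObjective {p q T : ℕ} (X : Matrix (Fin T) (Fin p) ℝ) (Y : Matrix (Fin T) (Fin q) ℝ)
    (lam : ℝ) (B : Matrix (Fin p) (Fin q) ℝ) : ℝ :=
  1 / (T : ℝ) * frob (Y - X * B) ^ 2 + lam * vecL1 B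

/-- `B` is a lasso estimator for the data `X`, `Y` with penalty `lam`. -/
def IsLasso {p q T : ℕ} (X : Matrix (Fin T) (Fin p) ℝ) (Y : Matrix (Fin T) (Fin q) ℝ)
    (lam : ℝ) (B : Matrix (Fin p) (Fin q) ℝ) : Prop :=
  IsMinOn (lassoObjective X Y lam) Set.univ B

/-! ### The explicit constants -/

/-- `η = λ_min(Σ_X) / (108 π S λ_max(Σ_X))`. -/
def eta {p : ℕ} (SigX : Matrix (Fin p) (Fin p) ℝ) (S : ℝ) : ℝ :=
  lambdaMin SigX / (108 * Real.pi * S * lambdaMax SigX)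

/-- `Q = 8 π √((b+1)/ct) (‖Σ_X‖ (1 + max_j ‖Θ_{:j}‖₂²) + ‖Σ_Y‖)`. -/
def multiplierQ {p q : ℕ} (b ct : ℝ) (SigX : Matrix (Fin p) (Fin p) ℝ)
    (SigY : Matrix (Fin q) (Fin q) ℝ) (Θ : Matrix (Fin p) (Fin q) ℝ) : ℝ :=
  8 * Real.pi * √((b + 1) / ct) * (opNorm SigX * (1 + maxColSq Θ) + opNorm SigY)

/-- `R = S √(log(pq) / T)`. -/
def rateR (p q T : ℕ) (S : ℝ) : ℝ := S * √(Real.log ((p : ℝ) * q) / T)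

end MixingLasso

end

/-!
The `α`-mixing coefficients of a Gaussian process control its correlations, and this turns the
theorem into a statement about quadratic forms of Gaussian vectors.

**From mixing to correlations.** Let `(U, V)` be centered Gaussian with unit variances and
correlation `r ≥ 0`. Writing `V = r U + W` with `W` independent of `U`, the quadrant
`{U > 0, V ≥ 0}` is seen to have probability at least `1/4 + κ r` for a universal `κ > 0`
(`gaussian_orthant_lower`). Testing the dependence coefficient on these two events gives
`κ |Cov(U, V)| ≤ α · sd(U) sd(V)` (`orthantConst_mul_abs_covariance_le`). Hence the covariance
matrix of a linear functional of the process over `T` time points has row sums at most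
`2 κ⁻¹ σ² S_α(T)`, where `σ²` is the variance of the functional.

**Concentration.** After rotation to an eigenbasis of its covariance matrix a Gaussian vector has
independent coordinates, so that the Chernoff bound yields a Hanson-Wright inequality
(`sum_sq_tail_of_gaussian`). Together with the row sum bound it controls the empirical variance of
every linear functional of the process (`empirical_variance_tail`).

**Restricted eigenvalues.** The empirical covariance need only be accurate on the `(2p)^k` sums of
`k` signed basis vectors, `k = 32 s + 2`, which a union bound affords. A general vector `v` is, up
to scale, the mean of such a random sum with independent terms, and computing the expectation of
the quadratic form shows that it is nonnegative up to a multiple of `‖v‖₁² / (k - 1)`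
(`quadratic_lower_of_signedSum`, Maurey's empirical method). On the cone of lasso errors
`‖Δ‖₁² ≤ 16 s ‖Δ‖_F²` this error is absorbed (`restricted_eigenvalue`). No covering of sparse unit
spheres is required.

**Score.** The residuals `W = Y - Θ'X` are uncorrelated with `X` by the normal equations, and
`X_i W_j` is the difference of the squares of `X_i ± W_j`, divided by four (`score_tail`). The union
bound over the `pq` entries accounts for the term `8 exp (-b log (pq))` in the Gaussian range of
the tail. In its exponential range, which the sample size condition does not exclude for large `b`,
the tail is of order `exp (-T / 32)` and is absorbed in the term `2 exp (-(c/2) T min(1, η²))`.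

On both events the classical deterministic argument applies (`lasso_bounds`).
-/

namespace MixingLasso

variable {Ω : Type*} [mΩ : MeasurableSpace Ω] {μ : Measure Ω}

/-! ### Correlation and α-dependence of Gaussian pairs -/

/-- The constant `P(N > 1) φ(1)` for a standard normal variable `N` with density `φ`. -/
noncomputable def orthantConst : ℝ :=
  (gaussianReal 0 1).real (Set.Ioi 1) * gaussianPDFReal 0 1 1

lemma orthantConst_pos : 0 < orthantConst := by
  refine mul_pos ?_ (gaussianPDFReal_pos 0 1 1 one_ne_zero)
  rw [measureReal_def, ENNReal.toReal_pos_iff]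
  refine ⟨?_, measure_lt_top _ _⟩
  rw [pos_iff_ne_zero]
  intro h
  have := gaussianReal_absolutelyContinuous' 0 (v := 1) one_ne_zero h
  simp at this

lemma gaussianReal_Ioi_zero {v : NNReal} (hv : v ≠ 0) :
    (gaussianReal 0 v).real (Set.Ioi 0) = 1 / 2 := by
  have hna := nullSingletonClass_gaussianReal (μ := 0) hv
  have h1 : (gaussianReal 0 v).real (Set.Iio 0) = (gaussianReal 0 v).real (Set.Ioi 0) := by
    conv_lhs => rw [show gaussianReal 0 v = (gaussianReal 0 v).map (fun x ↦ -x) by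
      rw [gaussianReal_map_neg, neg_zero]]
    rw [map_measureReal_apply measurable_neg measurableSet_Iio]
    congr 1
    ext x; simp
  have h2 := probReal_add_probReal_compl (μ := gaussianReal 0 v) (s := Set.Ioi 0) measurableSet_Ioi
  have h3 : (gaussianReal 0 v).real (Set.Ioi 0)ᶜ = (gaussianReal 0 v).real (Set.Iio 0) := by
    rw [Set.compl_Ioi]
    exact measureReal_congr Iio_ae_eq_Iic.symm
  linarith

lemma gaussianReal_Ici_zero {v : NNReal} (hv : v ≠ 0) :
    (gaussianReal 0 v).real (Set.Ici 0) = 1 / 2 := by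
  have hna := nullSingletonClass_gaussianReal (μ := 0) hv
  rw [← gaussianReal_Ioi_zero hv]
  exact measureReal_congr Ioi_ae_eq_Ici.symm

/-- Standard normal mass to the right of `-r`: on `[-r, 0]` the density is at least its value
at `1`. -/
lemma gaussianReal_Ici_neg_lower {r : ℝ} (h0 : 0 ≤ r) (h1 : r ≤ 1) :
    1 / 2 + r * gaussianPDFReal 0 1 1 ≤ (gaussianReal 0 1).real (Set.Ici (-r)) := by
  have hsplit : Set.Ici (-r) = Set.Ico (-r) 0 ∪ Set.Ici 0 :=
    (Set.Ico_union_Ici_eq_Ici (by linarith)).symm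
  have hdis : Disjoint (Set.Ico (-r) 0) (Set.Ici (0:ℝ)) := by
    rw [Set.disjoint_left]; intro x hx hx'; exact absurd hx.2 (not_lt.mpr hx')
  rw [hsplit, measureReal_union hdis measurableSet_Ici,
    gaussianReal_Ici_zero one_ne_zero, add_comm]
  gcongr
  rw [measureReal_def, gaussianReal_apply_eq_integral _ one_ne_zero, ENNReal.toReal_ofReal
    (integral_nonneg fun _ ↦ gaussianPDFReal_nonneg _ _ _)]
  have : r * gaussianPDFReal 0 1 1 = ∫ x in Set.Ico (-r) 0, gaussianPDFReal 0 1 1 := by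
    simp [h0]
  rw [this]
  refine setIntegral_mono_on (by simp) (integrable_gaussianPDFReal 0 1).integrableOn
    measurableSet_Ico ?_
  intro x hx
  simp only [gaussianPDFReal]
  gcongr ?_ * ?_
  apply Real.exp_le_exp.2
  have : x ^ 2 ≤ 1 := by have := hx.1; have := hx.2; nlinarith
  simp only [sub_zero, NNReal.coe_one]
  linarith

/-- A smaller variance concentrates more mass to the right of a negative point. Zero variance is
allowed. -/
lemma gaussianReal_Ici_neg_mono {v : NNReal} (hv : v ≤ 1) {r : ℝ} (h0 : 0 ≤ r) :
    (gaussianReal 0 1).real (Set.Ici (-r)) ≤ (gaussianReal 0 v).real (Set.Ici (-r)) := by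
  have h := gaussianReal_map_const_mul (μ := 0) (v := 1) (√(v : ℝ))
  have hv' : (NNReal.mk ((√(v : ℝ)) ^ 2) (sq_nonneg _)) * 1 = v := by
    ext; simp
  rw [mul_zero, hv'] at h
  rw [← h, map_measureReal_apply (by fun_prop) measurableSet_Ici]
  refine measureReal_mono ?_
  intro x hx
  simp only [Set.mem_Ici, Set.mem_preimage] at hx ⊢
  have hs : √(v : ℝ) ≤ 1 := Real.sqrt_le_one.2 (by exact_mod_cast hv)
  have hs0 := Real.sqrt_nonneg (v : ℝ)
  nlinarith

/-- Quadrant probability of a positively correlated Gaussian pair, by regressing `V` on `U`. The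
case of perfect correlation, where the regression residual is degenerate, is included. -/
theorem gaussian_orthant_lower {U V : Ω → ℝ}
    (hUV : HasGaussianLaw (fun ω ↦ (U ω, V ω)) μ) (hmU : Measurable U) (hmV : Measurable V)
    (hU0 : μ[U] = 0) (hV0 : μ[V] = 0) (hU1 : Var[U; μ] = 1) (hV1 : Var[V; μ] = 1)
    (hr : 0 ≤ cov[U, V; μ]) :
    1 / 4 + orthantConst * cov[U, V; μ] ≤ μ.real {ω | 0 < U ω ∧ 0 ≤ V ω} := by
  have hP := hUV.isProbabilityMeasure
  have hgU := hUV.fst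
  have hgV := hUV.snd
  have hLU := hgU.memLp_two
  have hLV := hgV.memLp_two
  set r := cov[U, V; μ] with hrdef
  set W : Ω → ℝ := fun ω ↦ V ω - r * U ω with hW
  have hUW : HasGaussianLaw (fun ω ↦ (U ω, W ω)) μ :=
    hUV.map_fun ((ContinuousLinearMap.fst ℝ ℝ ℝ).prod
      (ContinuousLinearMap.snd ℝ ℝ ℝ - r • ContinuousLinearMap.fst ℝ ℝ ℝ))
  have hLrU : MemLp (fun ω ↦ r * U ω) 2 μ := hLU.const_mul r
  have hcov : cov[U, W; μ] = 0 := by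
    rw [hW, covariance_fun_sub_right hLU hLV hLrU, covariance_const_mul_right,
      covariance_self hmU.aemeasurable, hU1]
    simp [hrdef]
  have hind := hUW.indepFun_of_covariance_eq_zero hcov
  have hmW : Measurable W := by fun_prop
  have hWvar : Var[W; μ] = 1 - r ^ 2 := by
    rw [hW, variance_fun_sub hLV hLrU, variance_const_mul, hU1, hV1, covariance_const_mul_right,
      covariance_comm, ← hrdef]
    ring
  have hW0 : μ[W] = 0 := by
    rw [hW, integral_sub (hLV.integrable (by norm_num)) (hLrU.integrable (by norm_num)),
      integral_const_mul, hU0, hV0]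
    simp
  have hr1 : r ≤ 1 := by
    have := variance_nonneg W μ
    nlinarith
  have hlawW := hUW.snd.map_eq_gaussianReal
  have hlawU := hgU.map_eq_gaussianReal
  rw [hU0, hU1, Real.toNNReal_one] at hlawU
  rw [hW0, hWvar] at hlawW
  have hv : (1 - r ^ 2).toNNReal ≤ 1 := by
    rw [Real.toNNReal_le_one]; nlinarith
  have key : ∀ (A : Set ℝ) (x : ℝ), MeasurableSet A → 0 ≤ x →
      (gaussianReal 0 1).real A * (gaussianReal 0 1).real (Set.Ici (-x)) ≤
        μ.real (U ⁻¹' A ∩ W ⁻¹' (Set.Ici (-x))) := by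
    intro A x hA hx
    rw [measureReal_def μ, hind.measure_inter_preimage_eq_mul A _ hA measurableSet_Ici,
      ENNReal.toReal_mul, ← Measure.map_apply hmU hA, ← Measure.map_apply hmW measurableSet_Ici,
      hlawU, hlawW]
    exact mul_le_mul_of_nonneg_left (gaussianReal_Ici_neg_mono hv hx) ENNReal.toReal_nonneg
  -- split the quadrant at `U = 1`; the gain of order `r` comes from the part `U > 1`
  have k1 := key (Set.Ioc 0 1) 0 measurableSet_Ioc le_rfl
  have k2 := key (Set.Ioi 1) r measurableSet_Ioi hr
  rw [neg_zero, gaussianReal_Ici_zero one_ne_zero] at k1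
  have hsum : (gaussianReal 0 1).real (Set.Ioc 0 1) + (gaussianReal 0 1).real (Set.Ioi 1)
      = 1 / 2 := by
    rw [← gaussianReal_Ioi_zero (v := 1) one_ne_zero, ← measureReal_union _ measurableSet_Ioi,
      Set.Ioc_union_Ioi_eq_Ioi zero_le_one]
    rw [Set.disjoint_left]; intro x hx hx'; exact absurd hx.2 (not_le.mpr hx')
  have k3 := gaussianReal_Ici_neg_lower hr hr1
  have hdis : Disjoint (U ⁻¹' (Set.Ioc 0 1) ∩ W ⁻¹' (Set.Ici 0))
      (U ⁻¹' (Set.Ioi 1) ∩ W ⁻¹' (Set.Ici (-r))) := by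
    rw [Set.disjoint_left]
    intro ω h h'
    exact absurd h.1.2 (not_le.mpr h'.1)
  have hsub : (U ⁻¹' (Set.Ioc 0 1) ∩ W ⁻¹' (Set.Ici 0)) ∪
      (U ⁻¹' (Set.Ioi 1) ∩ W ⁻¹' (Set.Ici (-r))) ⊆ {ω | 0 < U ω ∧ 0 ≤ V ω} := by
    rintro ω (⟨h1, h2⟩ | ⟨h1, h2⟩)
    · simp only [Set.mem_preimage, Set.mem_Ioc, Set.mem_Ici, hW] at h1 h2
      exact ⟨h1.1, by nlinarith [mul_nonneg hr h1.1.le]⟩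
    · simp only [Set.mem_preimage, Set.mem_Ioi, Set.mem_Ici, hW] at h1 h2
      exact ⟨by simpa using zero_lt_one.trans h1,
        by nlinarith⟩
  have hle := measureReal_mono (μ := μ) hsub
  rw [measureReal_union hdis ((hmU measurableSet_Ioi).inter (hmW measurableSet_Ici))] at hle
  have k4 := mul_le_mul_of_nonneg_left k3
    (measureReal_nonneg (μ := gaussianReal 0 1) (s := Set.Ioi 1))
  unfold orthantConst
  nlinarith

lemma abs_measureReal_inter_sub_le_one [IsProbabilityMeasure μ] (A B : Set Ω) :
    |μ.real (A ∩ B) - μ.real A * μ.real B| ≤ 1 := by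
  have h1 := measureReal_nonneg (μ := μ) (s := A ∩ B)
  have h2 : μ.real (A ∩ B) ≤ 1 := measureReal_le_one
  have h3 := measureReal_nonneg (μ := μ) (s := A)
  have h4 : μ.real A ≤ 1 := measureReal_le_one
  have h5 := measureReal_nonneg (μ := μ) (s := B)
  have h6 : μ.real B ≤ 1 := measureReal_le_one
  rw [abs_le]
  constructor <;> nlinarith [mul_nonneg h3 h5]

lemma covariance_eq_zero_of_variance_eq_zero [IsFiniteMeasure μ] {U V : Ω → ℝ}
    (hU : MemLp U 2 μ) (hV : MemLp V 2 μ) (h : Var[U; μ] = 0) : cov[U, V; μ] = 0 := by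
  by_contra hc
  -- otherwise the variance of `V - t U` would be negative for a suitable `t`
  have hv := variance_nonneg
    (fun ω ↦ V ω - ((Var[V; μ] + 1) / (2 * cov[U, V; μ])) * U ω) μ
  rw [variance_fun_sub hV (hU.const_mul _), variance_const_mul, covariance_const_mul_right,
    covariance_comm V U, h, mul_zero] at hv
  have : 2 * ((Var[V; μ] + 1) / (2 * cov[U, V; μ]) * cov[U, V; μ]) = Var[V; μ] + 1 := by
    field_simp
  linarith

section AlphaDep

variable {Ω : Type*} {𝒜 ℬ : MeasurableSpace Ω} [mΩ : MeasurableSpace Ω] {μ : Measure Ω}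

lemma abs_le_alphaDep [IsProbabilityMeasure μ] {A B : Set Ω}
    (hA : MeasurableSet[𝒜] A) (hB : MeasurableSet[ℬ] B) :
    |μ.real (A ∩ B) - μ.real A * μ.real B| ≤ alphaDep μ 𝒜 ℬ := by
  refine le_csSup ⟨1, ?_⟩ ⟨A, B, hA, hB, rfl⟩
  rintro r ⟨A, B, -, -, rfl⟩
  exact abs_measureReal_inter_sub_le_one A B

lemma alphaDep_nonneg [IsProbabilityMeasure μ] : 0 ≤ alphaDep μ 𝒜 ℬ :=
  (abs_nonneg _).trans (abs_le_alphaDep (μ := μ) (@MeasurableSet.empty _ 𝒜)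
    (@MeasurableSet.empty _ ℬ))

lemma alphaDep_le_one [IsProbabilityMeasure μ] : alphaDep μ 𝒜 ℬ ≤ 1 := by
  refine csSup_le ⟨_, ∅, ∅, @MeasurableSet.empty _ 𝒜, @MeasurableSet.empty _ ℬ, rfl⟩ ?_
  rintro r ⟨A, B, -, -, rfl⟩
  exact abs_measureReal_inter_sub_le_one A B

/-- Testing the dependence coefficient on the events `{U > 0}` and `{V ≥ 0}`. -/
theorem orthantConst_mul_covariance_le_alphaDep {U V : Ω → ℝ} (h𝒜 : 𝒜 ≤ mΩ) (hℬ : ℬ ≤ mΩ)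
    (hUV : HasGaussianLaw (fun ω ↦ (U ω, V ω)) μ) (hmU : Measurable[𝒜] U) (hmV : Measurable[ℬ] V)
    (hU0 : μ[U] = 0) (hV0 : μ[V] = 0) (hU1 : Var[U; μ] = 1) (hV1 : Var[V; μ] = 1)
    (hr : 0 ≤ cov[U, V; μ]) :
    orthantConst * cov[U, V; μ] ≤ alphaDep μ 𝒜 ℬ := by
  have hP := hUV.isProbabilityMeasure
  have hmU' : Measurable U := hmU.mono h𝒜 le_rfl
  have hmV' : Measurable V := hmV.mono hℬ le_rfl
  have h := gaussian_orthant_lower hUV hmU' hmV' hU0 hV0 hU1 hV1 hr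
  have hA : MeasurableSet[𝒜] (U ⁻¹' Set.Ioi 0) := hmU measurableSet_Ioi
  have hB : MeasurableSet[ℬ] (V ⁻¹' Set.Ici 0) := hmV measurableSet_Ici
  have hle := (le_abs_self _).trans (abs_le_alphaDep (μ := μ) hA hB)
  have hlawU := hUV.fst.map_eq_gaussianReal
  have hlawV := hUV.snd.map_eq_gaussianReal
  rw [hU0, hU1, Real.toNNReal_one] at hlawU
  rw [hV0, hV1, Real.toNNReal_one] at hlawV
  have hpU : μ.real (U ⁻¹' Set.Ioi 0) = 1 / 2 := by
    rw [← map_measureReal_apply hmU' measurableSet_Ioi, hlawU,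
      gaussianReal_Ioi_zero one_ne_zero]
  have hpV : μ.real (V ⁻¹' Set.Ici 0) = 1 / 2 := by
    rw [← map_measureReal_apply hmV' measurableSet_Ici, hlawV,
      gaussianReal_Ici_zero one_ne_zero]
  have heq : {ω | 0 < U ω ∧ 0 ≤ V ω} = U ⁻¹' Set.Ioi 0 ∩ V ⁻¹' Set.Ici 0 := rfl
  rw [hpU, hpV, ← heq] at hle
  linarith

/-- For jointly Gaussian variables the correlation is controlled by the `α` measure of dependence:
a correlation `r` already shows, up to a universal factor, in the quadrant events. -/
theorem orthantConst_mul_abs_covariance_le {U V : Ω → ℝ} (h𝒜 : 𝒜 ≤ mΩ) (hℬ : ℬ ≤ mΩ)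
    (hUV : HasGaussianLaw (fun ω ↦ (U ω, V ω)) μ) (hmU : Measurable[𝒜] U) (hmV : Measurable[ℬ] V)
    (hU0 : μ[U] = 0) (hV0 : μ[V] = 0) :
    orthantConst * |cov[U, V; μ]| ≤ alphaDep μ 𝒜 ℬ * (√Var[U; μ] * √Var[V; μ]) := by
  have hP := hUV.isProbabilityMeasure
  have hLU := hUV.fst.memLp_two
  have hLV := hUV.snd.memLp_two
  by_cases hcov : cov[U, V; μ] = 0
  · rw [hcov, abs_zero, mul_zero]
    exact mul_nonneg alphaDep_nonneg (by positivity)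
  have hvU : 0 < Var[U; μ] := (variance_nonneg U μ).lt_of_ne' fun h ↦
    hcov (covariance_eq_zero_of_variance_eq_zero hLU hLV h)
  have hvV : 0 < Var[V; μ] := (variance_nonneg V μ).lt_of_ne' fun h ↦
    hcov (covariance_comm U V ▸ covariance_eq_zero_of_variance_eq_zero hLV hLU h)
  have hsU := Real.sqrt_pos.2 hvU
  have hsV := Real.sqrt_pos.2 hvV
  obtain ⟨ε, hε, hεcov⟩ : ∃ ε : ℝ, ε ^ 2 = 1 ∧ ε * cov[U, V; μ] = |cov[U, V; μ]| := by
    rcases abs_choice (cov[U, V; μ]) with h | h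
    · exact ⟨1, by norm_num, by rw [h, one_mul]⟩
    · exact ⟨-1, by norm_num, by rw [h]; ring⟩
  set a := ε * (√Var[U; μ])⁻¹ with ha
  set b := (√Var[V; μ])⁻¹ with hb
  have hab : cov[fun ω ↦ a * U ω, fun ω ↦ b * V ω; μ]
      = |cov[U, V; μ]| / (√Var[U; μ] * √Var[V; μ]) := by
    rw [covariance_const_mul_left, covariance_const_mul_right, ← hεcov, ha, hb]
    field_simp
  have := orthantConst_mul_covariance_le_alphaDep (μ := μ) (U := fun ω ↦ a * U ω)
    (V := fun ω ↦ b * V ω) h𝒜 hℬ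
    (hUV.map_fun ((a • ContinuousLinearMap.fst ℝ ℝ ℝ).prod (b • ContinuousLinearMap.snd ℝ ℝ ℝ)))
    (hmU.const_mul a) (hmV.const_mul b)
    (by rw [integral_const_mul, hU0, mul_zero]) (by rw [integral_const_mul, hV0, mul_zero])
    (by rw [variance_const_mul, ha, mul_pow, hε, inv_pow, Real.sq_sqrt hvU.le]; field_simp)
    (by rw [variance_const_mul, hb, inv_pow, Real.sq_sqrt hvV.le]; field_simp)
    (by rw [hab]; positivity)
  rw [hab, ← mul_div_assoc, div_le_iff₀ (by positivity)] at this
  exact this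

end AlphaDep

/-! ### Concentration of Gaussian quadratic forms -/

lemma integrable_exp_mul_sq_gaussianReal {θ : ℝ} (hθ : |θ| ≤ 1 / 4) :
    Integrable (fun x ↦ Real.exp (θ * (x ^ 2 - 1))) (gaussianReal 0 1) := by
  have hθ' := (abs_le.1 hθ).2
  rw [gaussianReal_of_var_ne_zero _ one_ne_zero,
    integrable_withDensity_iff_integrable_smul₀' (by fun_prop)
      (ae_of_all _ fun _ ↦ gaussianPDF_lt_top)]
  have hb : 0 < 1 / 2 - θ := by linarith
  refine ((integrable_exp_neg_mul_sq hb).const_mul ((√(2 * Real.pi))⁻¹ * Real.exp (-θ))).congr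
    (ae_of_all _ fun x ↦ ?_)
  simp only [toReal_gaussianPDF, smul_eq_mul, gaussianPDFReal, NNReal.coe_one, mul_one, sub_zero]
  rw [mul_assoc, mul_assoc, ← Real.exp_add, ← Real.exp_add]
  congr 2
  ring

lemma integral_exp_mul_sq_gaussianReal_le {θ : ℝ} (hθ : |θ| ≤ 1 / 4) :
    ∫ x, Real.exp (θ * (x ^ 2 - 1)) ∂(gaussianReal 0 1) ≤ Real.exp (4 * θ ^ 2) := by
  have hθ' := (abs_le.1 hθ).2
  have hb : 0 < 1 / 2 - θ := by linarith
  have hb' : 0 < 1 - 2 * θ := by linarith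
  have h1 : ∫ x, Real.exp (θ * (x ^ 2 - 1)) ∂(gaussianReal 0 1)
      = (√(2 * Real.pi))⁻¹ * Real.exp (-θ) * √(Real.pi / (1 / 2 - θ)) := by
    rw [integral_gaussianReal_eq_integral_smul one_ne_zero, ← integral_gaussian,
      ← integral_const_mul]
    congr 1
    ext x
    simp only [smul_eq_mul, gaussianPDFReal, NNReal.coe_one, mul_one, sub_zero]
    rw [mul_assoc, mul_assoc, ← Real.exp_add, ← Real.exp_add]
    congr 2
    ring
  have h2 : (√(2 * Real.pi))⁻¹ * √(Real.pi / (1 / 2 - θ)) = Real.exp (-(Real.log (1 - 2 * θ)) / 2) := by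
    rw [← Real.sqrt_inv, ← Real.sqrt_mul (by positivity), Real.exp_half, Real.exp_neg,
      Real.exp_log hb']
    congr 1
    have := Real.pi_pos
    field_simp
  rw [h1, mul_right_comm, h2, ← Real.exp_add]
  apply Real.exp_le_exp.2
  have hx : |2 * θ| < 1 := by rw [abs_mul, abs_two]; linarith
  have h3 := Real.abs_log_sub_add_sum_range_le hx 1
  simp only [Finset.range_one, Finset.sum_singleton, zero_add, pow_one, Nat.cast_zero, div_one] at h3
  have h4 : |2 * θ| ^ (1 + 1) / (1 - |2 * θ|) ≤ 2 * (2 * θ) ^ 2 := by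
    have h5 : (1:ℝ) / 2 ≤ 1 - |2 * θ| := by rw [abs_mul, abs_two]; linarith
    rw [show 1 + 1 = 2 from rfl, sq_abs, div_le_iff₀ (by linarith)]
    nlinarith [sq_nonneg (2 * θ)]
  have h6 := (abs_le.1 (h3.trans h4)).1
  nlinarith

/-- A centered square of a Gaussian variable is sub-exponential. -/
lemma integrable_exp_mul_sq_of_gaussian {H : Ω → ℝ} (hH : HasGaussianLaw H μ) (h0 : μ[H] = 0)
    {θ : ℝ} (hθ : |θ| * Var[H; μ] ≤ 1 / 4) :
    Integrable (fun ω ↦ Real.exp (θ * (H ω ^ 2 - Var[H; μ]))) μ ∧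
      ∫ ω, Real.exp (θ * (H ω ^ 2 - Var[H; μ])) ∂μ ≤ Real.exp (4 * (θ * Var[H; μ]) ^ 2) := by
  have hv := variance_nonneg H μ
  set v := Var[H; μ] with hvdef
  have hlaw := hH.map_eq_gaussianReal
  rw [h0, ← hvdef] at hlaw
  have h := gaussianReal_map_const_mul (μ := 0) (v := 1) (√v)
  have hv' : (NNReal.mk ((√v) ^ 2) (sq_nonneg _)) * 1 = v.toNNReal := by
    ext; simp [Real.sq_sqrt hv, hv]
  rw [mul_zero, hv', ← hlaw] at h
  have hθ' : |θ * v| ≤ 1 / 4 := by rwa [abs_mul, abs_of_nonneg hv]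
  have heq : ∀ x : ℝ, Real.exp (θ * ((√v * x) ^ 2 - v)) = Real.exp (θ * v * (x ^ 2 - 1)) := by
    intro x
    rw [mul_pow, Real.sq_sqrt hv]
    congr 1; ring
  have hmeas : Measurable fun y : ℝ ↦ Real.exp (θ * (y ^ 2 - v)) := by fun_prop
  constructor
  · have h1 : Integrable (fun y ↦ Real.exp (θ * (y ^ 2 - v))) (μ.map H) := by
      rw [← h, integrable_map_measure hmeas.aestronglyMeasurable (by fun_prop)]
      refine (integrable_exp_mul_sq_gaussianReal hθ').congr (ae_of_all _ fun x ↦ ?_)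
      simp only [Function.comp_apply, heq]
    exact (integrable_map_measure hmeas.aestronglyMeasurable hH.aemeasurable).1 h1
  · have h1 : ∫ ω, Real.exp (θ * (H ω ^ 2 - v)) ∂μ
        = ∫ y, Real.exp (θ * (y ^ 2 - v)) ∂(μ.map H) :=
      (integral_map hH.aemeasurable hmeas.aestronglyMeasurable).symm
    rw [h1, ← h, integral_map (by fun_prop) hmeas.aestronglyMeasurable]
    simp only [heq]
    exact integral_exp_mul_sq_gaussianReal_le hθ'

/-- Bernstein's inequality for the squares of independent centered normal variables. -/
theorem bernstein_of_iIndepFun {ι : Type*} [Fintype ι] {H : ι → Ω → ℝ}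
    (hind : iIndepFun H μ) (hm : ∀ i, Measurable (H i)) (hG : ∀ i, HasGaussianLaw (H i) μ)
    (h0 : ∀ i, μ[H i] = 0) {M : ℝ} (hM : 0 < M) (hvar : ∀ i, Var[H i; μ] ≤ M)
    {u : ℝ} (hu : 0 ≤ u) :
    μ.real {ω | Fintype.card ι * M * u ≤ |∑ i, (H i ω ^ 2 - Var[H i; μ])|}
      ≤ 2 * Real.exp (-(Fintype.card ι * min u (u ^ 2) / 16)) := by
  have hP := hind.isProbabilityMeasure
  set n : ℝ := (Fintype.card ι : ℝ) with hn
  have hn0 : 0 ≤ n := by positivity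
  -- the Chernoff exponent is `m / (8 M)`, truncated at `u = 1` to stay where the mgf is finite
  set m : ℝ := min u 1 with hm'
  have hm0 : 0 ≤ m := le_min hu zero_le_one
  have hm1 : m ≤ 1 := min_le_right _ _
  have hmu : m ≤ u := min_le_left _ _
  have hmm : min u (u ^ 2) = m * u := by
    rw [hm', min_mul_of_nonneg _ _ hu, one_mul, min_comm, sq]
  set W : ι → Ω → ℝ := fun i ω ↦ H i ω ^ 2 - Var[H i; μ] with hW
  have hWind : iIndepFun W μ :=
    hind.comp (fun i x ↦ x ^ 2 - Var[H i; μ]) (fun i ↦ by fun_prop)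
  have hWm : ∀ i, Measurable (W i) := fun i ↦ by simp only [hW]; fun_prop
  have hbound : ∀ θ : ℝ, |θ| = m / (8 * M) →
      Integrable (fun ω ↦ Real.exp (θ * (∑ i, W i) ω)) μ ∧
      mgf (∑ i, W i) μ θ ≤ Real.exp (n * (m ^ 2 / 16)) := by
    intro θ hθ
    have hθv : ∀ i, |θ| * Var[H i; μ] ≤ m / 8 := fun i ↦ by
      calc |θ| * Var[H i; μ] ≤ |θ| * M := by gcongr; exact hvar i
        _ = m / 8 := by rw [hθ]; field_simp
    have hi : ∀ i, _ := fun i ↦ integrable_exp_mul_sq_of_gaussian (hG i) (h0 i) (θ := θ)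
      ((hθv i).trans (by linarith))
    refine ⟨hWind.integrable_exp_mul_sum hWm fun i _ ↦ (hi i).1, ?_⟩
    rw [hWind.mgf_sum hWm]
    calc ∏ i, mgf (W i) μ θ ≤ ∏ _i : ι, Real.exp (m ^ 2 / 16) := by
          refine Finset.prod_le_prod (fun i _ ↦ mgf_nonneg) fun i _ ↦ (hi i).2.trans ?_
          apply Real.exp_le_exp.2
          have h1 := hθv i
          have h2 : 0 ≤ |θ| * Var[H i; μ] := mul_nonneg (abs_nonneg _) (variance_nonneg _ _)
          have h3 : (θ * Var[H i; μ]) ^ 2 = (|θ| * Var[H i; μ]) ^ 2 := by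
            rw [mul_pow, mul_pow, sq_abs]
          rw [h3]
          nlinarith
      _ = Real.exp (n * (m ^ 2 / 16)) := by
          rw [Finset.prod_const, ← Real.exp_nat_mul, Finset.card_univ]
  have hexp : ∀ B : ℝ, B ≤ Real.exp (n * (m ^ 2 / 16)) →
      Real.exp (-(m / (8 * M)) * (n * M * u)) * B
        ≤ Real.exp (-(n * min u (u ^ 2) / 16)) := by
    intro B hB
    calc _ ≤ Real.exp (-(m / (8 * M)) * (n * M * u)) * Real.exp (n * (m ^ 2 / 16)) := by gcongr
      _ ≤ _ := by
        rw [← Real.exp_add]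
        apply Real.exp_le_exp.2
        rw [hmm, show -(m / (8 * M)) * (n * M * u) = - (n * (m * u) / 8) by field_simp]
        have : m ^ 2 ≤ m * u := by nlinarith
        nlinarith [mul_le_mul_of_nonneg_left this hn0]
  have hc : |m / (8 * M)| = m / (8 * M) := abs_of_nonneg (by positivity)
  have up := hbound (m / (8 * M)) hc
  have dn := hbound (-(m / (8 * M))) (by rw [abs_neg, hc])
  have h1 := (measure_ge_le_exp_mul_mgf (n * M * u) (by positivity) up.1).trans (hexp _ up.2)
  have h2 := measure_le_le_exp_mul_mgf (-(n * M * u)) (neg_nonpos.2 (by positivity)) dn.1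
  rw [neg_neg, mul_neg, ← neg_mul (m / (8 * M)) (n * M * u)] at h2
  replace h2 := h2.trans (hexp _ dn.2)
  have hsub : {ω | n * M * u ≤ |∑ i, (H i ω ^ 2 - Var[H i; μ])|} ⊆
      {ω | n * M * u ≤ (∑ i, W i) ω} ∪ {ω | (∑ i, W i) ω ≤ -(n * M * u)} := by
    intro ω hω
    simp only [Set.mem_ofPred_eq, Set.mem_union, Finset.sum_apply, hW] at hω ⊢
    rcases le_abs.1 hω with h | h
    · exact Or.inl h
    · exact Or.inr (by linarith)
  calc _ ≤ _ := measureReal_mono hsub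
    _ ≤ _ := measureReal_union_le _ _
    _ ≤ _ := by linarith

/-- Hanson-Wright inequality for the squared norm of a centered Gaussian vector: rotate to an
eigenbasis of the covariance matrix, where the coordinates are independent. -/
theorem sum_sq_tail_of_gaussian {ι : Type*} [Fintype ι] {G : ι → Ω → ℝ}
    (hG : HasGaussianLaw (fun ω ↦ (G · ω)) μ) (hm : ∀ i, Measurable (G i))
    (h0 : ∀ i, μ[G i] = 0) {M : ℝ} (hM : 0 < M)
    (hK : ∀ x : ι → ℝ, ∑ i, ∑ j, x i * x j * cov[G i, G j; μ] ≤ M * ∑ i, x i ^ 2)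
    {u : ℝ} (hu : 0 ≤ u) :
    μ.real {ω | Fintype.card ι * M * u ≤ |∑ i, (G i ω ^ 2 - Var[G i; μ])|}
      ≤ 2 * Real.exp (-(Fintype.card ι * min u (u ^ 2) / 16)) := by
  classical
  have hP := hG.isProbabilityMeasure
  have hL : ∀ i, MemLp (G i) 2 μ := fun i ↦ (hG.eval i).memLp_two
  set K : Matrix ι ι ℝ := Matrix.of fun i j ↦ cov[G i, G j; μ] with hKdef
  have hH : K.IsHermitian := by
    ext i j
    simp [hKdef, covariance_comm]
  set e := hH.eigenvectorBasis
  set H : ι → Ω → ℝ := fun i ω ↦ ∑ j, e i j * G j ω with hHdef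
  have hLe : ∀ i j, MemLp (fun ω ↦ e i j * G j ω) 2 μ := fun i j ↦ (hL j).const_mul _
  have horth : ∀ i k, ∑ a, e i a * e k a = if i = k then 1 else 0 := by
    intro i k
    have := orthonormal_iff_ite.1 e.orthonormal i k
    rw [← this, PiLp.inner_apply]
    simp [mul_comm]
  have hcov : ∀ i k, cov[H i, H k; μ] = if i = k then hH.eigenvalues k else 0 := by
    intro i k
    have h1 : cov[H i, H k; μ] = ∑ a, ∑ b, e i a * e k b * K a b := by
      rw [hHdef, covariance_fun_sum_fun_sum (hLe i) (hLe k)]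
      refine Finset.sum_congr rfl fun a _ ↦ Finset.sum_congr rfl fun b _ ↦ ?_
      rw [covariance_const_mul_left, covariance_const_mul_right, hKdef, Matrix.of_apply]
      ring
    have h2 : ∀ a, ∑ b, K a b * e k b = hH.eigenvalues k * e k a := fun a ↦
      congrFun (hH.mulVec_eigenvectorBasis k) a
    rw [h1]
    calc _ = ∑ a, e i a * ∑ b, K a b * e k b := by
          refine Finset.sum_congr rfl fun a _ ↦ ?_
          rw [Finset.mul_sum]
          exact Finset.sum_congr rfl fun b _ ↦ by ring
      _ = hH.eigenvalues k * ∑ a, e i a * e k a := by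
          rw [Finset.mul_sum]
          exact Finset.sum_congr rfl fun a _ ↦ by rw [h2]; ring
      _ = _ := by rw [horth]; simp
  have hmH : ∀ i, Measurable (H i) := fun i ↦
    Finset.measurable_fun_sum _ fun j _ ↦ (hm j).const_mul _
  have hvarH : ∀ i, Var[H i; μ] = hH.eigenvalues i := fun i ↦ by
    rw [← covariance_self (hmH i).aemeasurable, hcov, if_pos rfl]
  have hgH : HasGaussianLaw (fun ω ↦ (H · ω)) μ :=
    hG.map_fun (ContinuousLinearMap.pi fun i ↦ ∑ j, e i j • ContinuousLinearMap.proj j) |>.congr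
      (ae_of_all _ fun ω ↦ by ext i; simp [hHdef])
  have hind : iIndepFun H μ := hgH.iIndepFun_of_covariance_eq_zero fun i j hij ↦ by
    rw [hcov, if_neg hij]
  have hvM : ∀ i, Var[H i; μ] ≤ M := by
    intro i
    have h1 := hK (e i)
    have h2 : ∑ a, e i a ^ 2 = 1 := by
      simpa [sq] using horth i i
    rw [h2, mul_one] at h1
    refine le_trans (le_of_eq ?_) h1
    rw [← covariance_self (hmH i).aemeasurable, hHdef, covariance_fun_sum_fun_sum (hLe i) (hLe i)]
    refine Finset.sum_congr rfl fun a _ ↦ Finset.sum_congr rfl fun b _ ↦ ?_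
    rw [covariance_const_mul_left, covariance_const_mul_right]
    ring
  have hH0 : ∀ i, μ[H i] = 0 := by
    intro i
    rw [hHdef, integral_finsetSum _ fun j _ ↦ (hLe i j).integrable (by norm_num)]
    simp [integral_const_mul, h0]
  -- the rotation preserves the sum of squares
  have hsq : ∀ ω, ∑ i, H i ω ^ 2 = ∑ i, G i ω ^ 2 := by
    intro ω
    have h1 := e.sum_sq_norm_inner_right (WithLp.toLp 2 fun j ↦ G j ω)
    rw [EuclideanSpace.norm_sq_eq] at h1
    simp only [PiLp.inner_apply, RCLike.inner_apply, conj_trivial, Real.norm_eq_abs, sq_abs] at h1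
    rw [← h1]
    refine Finset.sum_congr rfl fun i _ ↦ ?_
    simp only [hHdef]
    congr 1
    exact Finset.sum_congr rfl fun j _ ↦ mul_comm _ _
  have hvsum : ∑ i, Var[H i; μ] = ∑ i, Var[G i; μ] := by
    have h1 : ∀ i, Var[H i; μ] = ∫ ω, H i ω ^ 2 ∂μ := fun i ↦
      variance_of_integral_eq_zero (hmH i).aemeasurable (hH0 i)
    have h2 : ∀ i, Var[G i; μ] = ∫ ω, G i ω ^ 2 ∂μ := fun i ↦
      variance_of_integral_eq_zero (hm i).aemeasurable (h0 i)
    simp only [h1, h2]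
    rw [← integral_finsetSum _ fun i _ ↦ ((hgH.eval i).memLp_two).integrable_sq,
      ← integral_finsetSum _ fun i _ ↦ (hL i).integrable_sq]
    simp only [hsq]
  have hfin := bernstein_of_iIndepFun hind hmH (fun i ↦ hgH.eval i) hH0 hM hvM hu
  simpa only [Finset.sum_sub_distrib, hsq, hvsum] using hfin

/-! ### Maurey's empirical method -/

/-- The expectation of `B (z + N) (z + N)`, for `N` a sum of `m` independent copies of the random
vector taking the value `x i` with probability `π i`, is attained or undercut by some outcome. -/
lemma exists_sum_le_average {V κ : Type*} [AddCommGroup V] [Module ℝ V] [Fintype κ]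
    (B : V →ₗ[ℝ] V →ₗ[ℝ] ℝ) (hB : ∀ x y, B x y = B y x) (x : κ → V) (π : κ → ℝ)
    (hπ0 : ∀ i, 0 ≤ π i) (hπ1 : ∑ i, π i = 1) (w : V) (hw : ∑ i, π i • x i = w) (m : ℕ) (z : V) :
    ∃ J : Fin m → κ, B (z + ∑ a, x (J a)) (z + ∑ a, x (J a)) ≤
      B z z + 2 * m * B z w + m * (m - 1) * B w w + m * ∑ i, π i * B (x i) (x i) := by
  induction m generalizing z with
  | zero => exact ⟨Fin.elim0, by simp⟩
  | succ m ih =>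
    set τ := ∑ i, π i * B (x i) (x i) with hτ
    have hw' : ∀ y, ∑ i, π i * B y (x i) = B y w := fun y ↦ by
      rw [← hw, map_sum]
      exact Finset.sum_congr rfl fun i _ ↦ by rw [map_smul, smul_eq_mul]
    have hzw := hw' z
    have hww : ∑ i, π i * B (x i) w = B w w := by
      simp only [hB _ w, hw']
    -- `g i` is the claimed bound after the first term `x i` has been added to `z`
    set g : κ → ℝ := fun i ↦ B (z + x i) (z + x i) + 2 * m * B (z + x i) w
      + m * (m - 1) * B w w + m * τ with hg
    set R : ℝ := B z z + 2 * (m + 1) * B z w + (m + 1) * m * B w w + (m + 1) * τ with hR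
    have havg : ∑ i, π i * g i = ∑ i, π i * R := by
      have h1 : ∀ i, π i * g i = π i * (B z z + 2 * m * B z w + m * (m - 1) * B w w + m * τ)
          + 2 * (π i * B z (x i)) + π i * B (x i) (x i) + 2 * m * (π i * B (x i) w) := by
        intro i
        simp only [hg, map_add, LinearMap.add_apply, hB (x i) z]
        ring
      simp only [h1, Finset.sum_add_distrib, ← Finset.sum_mul, ← Finset.mul_sum, hzw, hww, hπ1,
        ← hτ]
      rw [hR]
      ring
    obtain ⟨i, hi⟩ : ∃ i, g i ≤ R := by
      by_contra! hcon
      have hpos : ∃ i, 0 < π i := by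
        by_contra! hle
        have : ∑ i, π i ≤ 0 := Finset.sum_nonpos fun i _ ↦ hle i
        linarith
      obtain ⟨i₀, hi₀⟩ := hpos
      have : ∑ i, π i * R < ∑ i, π i * g i :=
        Finset.sum_lt_sum (fun i _ ↦ mul_le_mul_of_nonneg_left (hcon i).le (hπ0 i))
          ⟨i₀, Finset.mem_univ _, mul_lt_mul_of_pos_left (hcon i₀) hi₀⟩
      linarith
    obtain ⟨J, hJ⟩ := ih (z + x i)
    refine ⟨Fin.cons i J, ?_⟩
    rw [Fin.sum_univ_succ]
    simp only [Fin.cons_zero, Fin.cons_succ]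
    rw [← add_assoc]
    refine hJ.trans (hi.trans (le_of_eq ?_))
    rw [hR]
    push_cast
    ring

/-- The sum of the signed basis vectors `± e_i` listed by `J`; the sign is `+` for `true`. -/
noncomputable def signedSum {ι : Type*} [DecidableEq ι] {k : ℕ} (J : Fin k → ι × Bool) : ι → ℝ :=
  ∑ a, (if (J a).2 then (1 : ℝ) else -1) • Pi.single (J a).1 1

/-- A quadratic form that is nonnegative at every sum of `k` signed basis vectors is almost
nonnegative everywhere, up to a multiple of the squared `ℓ₁` norm (Maurey's empirical method). -/
theorem quadratic_lower_of_signedSum {ι : Type*} [Fintype ι] [DecidableEq ι]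
    {E : Matrix ι ι ℝ} (hE : E.IsSymm) {k : ℕ} (hk : 1 ≤ k)
    (hJ : ∀ J : Fin k → ι × Bool, 0 ≤ signedSum J ⬝ᵥ E *ᵥ signedSum J) {C : ℝ}
    (hC : ∀ i, E i i ≤ C) (v : ι → ℝ) :
    0 ≤ ((k : ℝ) - 1) * (v ⬝ᵥ E *ᵥ v) + C * (∑ i, |v i|) ^ 2 := by
  set L := ∑ i, |v i| with hL
  have hL0 : 0 ≤ L := Finset.sum_nonneg fun i _ ↦ abs_nonneg _
  rcases hL0.eq_or_lt with h0 | hLpos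
  · have hv : v = 0 := by
      ext i
      have := (Finset.sum_eq_zero_iff_of_nonneg (fun i _ ↦ abs_nonneg (v i))).1 h0.symm i
        (Finset.mem_univ i)
      simpa using this
    simp [← h0, hv]
  set B : (ι → ℝ) →ₗ[ℝ] (ι → ℝ) →ₗ[ℝ] ℝ := Matrix.toLinearMap₂' ℝ E
  have hBapp : ∀ x y, B x y = x ⬝ᵥ E *ᵥ y := fun x y ↦ Matrix.toLinearMap₂'_apply' E x y
  have hB : ∀ x y, B x y = B y x := by
    intro x y
    rw [hBapp, hBapp, Matrix.dotProduct_mulVec, ← Matrix.mulVec_transpose, hE.eq,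
      dotProduct_comm]
  -- sample `sign (v i) e_i` with probability `|v i| / ‖v‖₁`; the mean is `v / ‖v‖₁`
  set x : ι → ι → ℝ := fun i ↦ (if decide (0 ≤ v i) then (1 : ℝ) else -1) • Pi.single i 1 with hx
  have hxx : ∀ i, B (x i) (x i) = E i i := by
    intro i
    have h1 : B (Pi.single i 1) (Pi.single i 1) = E i i := by
      rw [hBapp]; simp
    simp only [hx, map_smul, LinearMap.smul_apply, h1, smul_eq_mul]
    split_ifs <;> ring
  have hw : ∑ i, (|v i| / L) • x i = L⁻¹ • v := by
    ext j
    simp only [hx, Finset.sum_apply, Pi.smul_apply, smul_eq_mul, Pi.single_apply]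
    rw [Finset.sum_eq_single j (fun i _ hij ↦ by simp [hij.symm]) (by simp)]
    rcases le_or_gt 0 (v j) with h | h
    · simp [h, abs_of_nonneg h, div_eq_inv_mul]
    · simp [h.not_ge, abs_of_neg h, div_eq_inv_mul]
  obtain ⟨J, hJle⟩ := exists_sum_le_average B hB x (fun i ↦ |v i| / L)
    (fun i ↦ by positivity) (by rw [← Finset.sum_div, ← hL, div_self hLpos.ne']) _ hw k 0
  have hs := hJ fun a ↦ (J a, decide (0 ≤ v (J a)))
  have hsum : signedSum (fun a ↦ (J a, decide (0 ≤ v (J a)))) = ∑ a, x (J a) := rfl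
  rw [hsum, ← hBapp] at hs
  simp only [zero_add, map_zero, LinearMap.zero_apply, mul_zero, hxx, map_smul,
    LinearMap.smul_apply, smul_eq_mul, hBapp v v] at hJle
  have hdiag : ∑ i, |v i| / L * E i i ≤ C := by
    calc ∑ i, |v i| / L * E i i ≤ ∑ i, |v i| / L * C :=
          Finset.sum_le_sum fun i _ ↦ mul_le_mul_of_nonneg_left (hC i) (by positivity)
      _ = C := by rw [← Finset.sum_mul, ← Finset.sum_div, ← hL, div_self hLpos.ne', one_mul]
  have hk' : (0 : ℝ) < k := by exact_mod_cast hk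
  have h2 : 0 ≤ (k : ℝ) * (((k : ℝ) - 1) * (L⁻¹ * (L⁻¹ * (v ⬝ᵥ E *ᵥ v))) + C) := by
    calc (0 : ℝ) ≤ _ := hs.trans hJle
      _ ≤ k * (k - 1) * (L⁻¹ * (L⁻¹ * (v ⬝ᵥ E *ᵥ v))) + k * C := by gcongr
      _ = _ := by ring
  have h3 := nonneg_of_mul_nonneg_right h2 hk'
  have h4 := mul_nonneg h3 (sq_nonneg L)
  have h5 : (((k : ℝ) - 1) * (L⁻¹ * (L⁻¹ * (v ⬝ᵥ E *ᵥ v))) + C) * L ^ 2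
      = ((k : ℝ) - 1) * (v ⬝ᵥ E *ᵥ v) + C * L ^ 2 := by
    field_simp
  rwa [h5] at h4

/-! ### Deterministic analysis of the lasso -/

lemma frob_nonneg {m n : ℕ} (M : Matrix (Fin m) (Fin n) ℝ) : 0 ≤ frob M := Real.sqrt_nonneg _

lemma frob_sq {m n : ℕ} (M : Matrix (Fin m) (Fin n) ℝ) : frob M ^ 2 = ∑ i, ∑ j, M i j ^ 2 :=
  Real.sq_sqrt (Finset.sum_nonneg fun _ _ ↦ Finset.sum_nonneg fun _ _ ↦ sq_nonneg _)

lemma frob_smul_of_nonneg {m n : ℕ} {c : ℝ} (hc : 0 ≤ c) (M : Matrix (Fin m) (Fin n) ℝ) :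
    frob (c • M) = c * frob M := by
  rw [frob, frob, ← Real.sqrt_sq hc, ← Real.sqrt_mul (sq_nonneg c), Real.sqrt_sq hc]
  congr 1
  simp only [Finset.mul_sum, Matrix.smul_apply, smul_eq_mul, mul_pow]

lemma frob_transpose_mul_self_le {m n : ℕ} (A : Matrix (Fin m) (Fin n) ℝ) :
    frob (Aᵀ * A) ≤ frob A ^ 2 := by
  refine Real.sqrt_le_iff.2 ⟨sq_nonneg _, ?_⟩
  rw [frob_sq, Finset.sum_comm (f := fun t j ↦ A t j ^ 2), sq, Finset.sum_mul_sum]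
  refine Finset.sum_le_sum fun j _ ↦ Finset.sum_le_sum fun l _ ↦ ?_
  simp only [Matrix.mul_apply, Matrix.transpose_apply]
  exact Finset.sum_mul_sq_le_sq_mul_sq _ _ _

/-- Deterministic guarantees of the lasso, on the event that the noise is dominated by the penalty
and that the design satisfies a restricted eigenvalue condition on the cone of error matrices. -/
theorem lasso_bounds {p q T s : ℕ} {X : Matrix (Fin T) (Fin p) ℝ} {Y : Matrix (Fin T) (Fin q) ℝ}
    {Θ Θhat : Matrix (Fin p) (Fin q) ℝ} {lam α : ℝ} (hlam : 0 < lam) (hα : 0 < α)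
    (hs : sparsity Θ = s)
    (hdev : ∀ i j, |1 / (T : ℝ) * (Xᵀ * (Y - X * Θ)) i j| ≤ lam / 4)
    (hRE : ∀ Δ : Matrix (Fin p) (Fin q) ℝ, vecL1 Δ ^ 2 ≤ 16 * s * frob Δ ^ 2 →
      α * frob Δ ^ 2 ≤ 1 / (T : ℝ) * frob (X * Δ) ^ 2)
    (hlasso : IsLasso X Y lam Θhat) :
    frob (Θhat - Θ) ≤ 4 * √s * lam / α ∧
      1 / (T : ℝ) * frob (X * (Θhat - Θ)) ^ 2 ≤ 32 * lam ^ 2 * s / α ∧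
      frob ((Θhat - Θ)ᵀ * empCov X * (Θhat - Θ)) ≤ 32 * lam ^ 2 * s / α := by
  classical
  set Δ := Θhat - Θ with hΔ
  set W := Y - X * Θ with hW
  set pred := 1 / (T : ℝ) * frob (X * Δ) ^ 2 with hpred
  have hT0 : 0 ≤ 1 / (T : ℝ) := by positivity
  have hpred0 : 0 ≤ pred := by positivity
  have hmin : lassoObjective X Y lam Θhat ≤ lassoObjective X Y lam Θ := hlasso (Set.mem_univ Θ)
  have hYX : Y - X * Θhat = W - X * Δ := by
    rw [hW, hΔ, Matrix.mul_sub]; abel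
  have hexpand : frob (W - X * Δ) ^ 2
      = frob W ^ 2 - 2 * ∑ i, ∑ j, (Xᵀ * W) i j * Δ i j + frob (X * Δ) ^ 2 := by
    have hcross : ∑ t, ∑ j, W t j * (X * Δ) t j = ∑ i, ∑ j, (Xᵀ * W) i j * Δ i j := by
      simp only [Matrix.mul_apply, Matrix.transpose_apply, Finset.mul_sum, Finset.sum_mul]
      rw [Finset.sum_comm]
      conv_rhs => rw [Finset.sum_comm]
      refine Finset.sum_congr rfl fun j _ ↦ ?_
      rw [Finset.sum_comm]
      exact Finset.sum_congr rfl fun i _ ↦ Finset.sum_congr rfl fun t _ ↦ by ring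
    rw [← hcross]
    simp only [frob_sq, Finset.mul_sum, ← Finset.sum_sub_distrib, ← Finset.sum_add_distrib,
      Matrix.sub_apply]
    exact Finset.sum_congr rfl fun i _ ↦ Finset.sum_congr rfl fun t _ ↦ by ring
  have hnoise : 1 / (T : ℝ) * ∑ i, ∑ j, (Xᵀ * W) i j * Δ i j ≤ lam / 4 * vecL1 Δ := by
    rw [vecL1]
    simp only [Finset.mul_sum]
    refine Finset.sum_le_sum fun i _ ↦ Finset.sum_le_sum fun j _ ↦ ?_
    rw [← mul_assoc]
    refine (le_abs_self _).trans ?_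
    rw [abs_mul]
    exact mul_le_mul_of_nonneg_right (hdev i j) (abs_nonneg _)
  simp only [lassoObjective, hYX, ← hW, hexpand] at hmin
  have hbasic : pred ≤ lam / 2 * vecL1 Δ + lam * (vecL1 Θ - vecL1 Θhat) := by
    rw [hpred]
    have : 1 / (T : ℝ) * (frob W ^ 2 - 2 * ∑ i, ∑ j, (Xᵀ * W) i j * Δ i j + frob (X * Δ) ^ 2)
      = 1 / (T : ℝ) * frob W ^ 2 - 2 * (1 / (T : ℝ) * ∑ i, ∑ j, (Xᵀ * W) i j * Δ i j)
        + 1 / (T : ℝ) * frob (X * Δ) ^ 2 := by ring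
    linarith
  -- split the `ℓ₁` norm of the error over the support of `Θ`
  set A : Finset (Fin p × Fin q) := Finset.univ.filter fun ij ↦ Θ ij.1 ij.2 ≠ 0 with hA
  have hcard : (A.card : ℝ) = s := by
    rw [← hs, sparsity, Set.ncard_eq_toFinset_card', hA]
    congr 2
    ext ij; simp
  set a := ∑ ij ∈ A, |Δ ij.1 ij.2| with ha
  set b := ∑ ij ∈ Aᶜ, |Δ ij.1 ij.2| with hb
  have hab : vecL1 Δ = a + b := by
    rw [vecL1, ← Fintype.sum_prod_type', ha, hb, Finset.sum_add_sum_compl]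
  have ha0 : 0 ≤ a := Finset.sum_nonneg fun _ _ ↦ abs_nonneg _
  have hb0 : 0 ≤ b := Finset.sum_nonneg fun _ _ ↦ abs_nonneg _
  have hdiff : vecL1 Θ - vecL1 Θhat ≤ a - b := by
    rw [vecL1, vecL1, ← Fintype.sum_prod_type', ← Fintype.sum_prod_type', ha, hb,
      ← Finset.sum_sub_distrib, ← Finset.sum_add_sum_compl A, sub_eq_add_neg,
      ← Finset.sum_neg_distrib]
    refine add_le_add (Finset.sum_le_sum fun ij _ ↦ ?_) (Finset.sum_le_sum fun ij hij ↦ ?_)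
    · rw [hΔ, Matrix.sub_apply, abs_sub_comm]
      exact abs_sub_abs_le_abs_sub _ _
    · have : Θ ij.1 ij.2 = 0 := by
        by_contra h
        exact (Finset.mem_compl.1 hij) (by simp [hA, h])
      simp [hΔ, this]
  -- basic inequality: the error lies in the cone `b ≤ 3 a`
  have hcone : pred + lam / 2 * b ≤ 3 / 2 * lam * a := by
    have := mul_le_mul_of_nonneg_left hdiff hlam.le
    rw [hab] at hbasic
    linarith
  have hb3 : b ≤ 3 * a := by nlinarith
  have haF : a ≤ √s * frob Δ := by
    have h1 : a ^ 2 ≤ s * frob Δ ^ 2 := by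
      calc a ^ 2 ≤ A.card * ∑ ij ∈ A, |Δ ij.1 ij.2| ^ 2 := sq_sum_le_card_mul_sum_sq
        _ ≤ s * frob Δ ^ 2 := by
          rw [hcard, frob_sq, ← Fintype.sum_prod_type']
          simp only [sq_abs]
          exact mul_le_mul_of_nonneg_left (Finset.sum_le_univ_sum_of_nonneg fun _ ↦ sq_nonneg _)
            (by positivity)
    rw [← abs_of_nonneg ha0, ← Real.sqrt_sq (frob_nonneg Δ), ← Real.sqrt_mul (by positivity)]
    exact Real.abs_le_sqrt h1
  have hF0 := frob_nonneg Δ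
  have hs0 : (0 : ℝ) ≤ √s := Real.sqrt_nonneg _
  have hss : √(s : ℝ) ^ 2 = s := Real.sq_sqrt (by positivity)
  have hL1 : vecL1 Δ ^ 2 ≤ 16 * s * frob Δ ^ 2 := by
    have h1 : vecL1 Δ ≤ 4 * (√s * frob Δ) := by rw [hab]; linarith
    have h2 : 0 ≤ vecL1 Δ := by rw [hab]; positivity
    calc vecL1 Δ ^ 2 ≤ (4 * (√s * frob Δ)) ^ 2 := by gcongr
      _ = 16 * (√(s : ℝ) ^ 2) * frob Δ ^ 2 := by ring
      _ = _ := by rw [hss]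
  have hre := hRE Δ hL1
  have hpredle : pred ≤ 3 / 2 * lam * (√s * frob Δ) := by
    have h1 := mul_le_mul_of_nonneg_left haF hlam.le
    nlinarith [mul_nonneg hlam.le hb0]
  have hF : frob Δ ≤ 3 / 2 * lam * √s / α := by
    rw [le_div_iff₀ hα]
    rcases hF0.eq_or_lt with h | h
    · rw [← h, zero_mul]; positivity
    · have : frob Δ * (frob Δ * α) ≤ frob Δ * (3 / 2 * lam * √s) := by nlinarith
      exact le_of_mul_le_mul_left this h
  have hpredfin : pred ≤ 32 * lam ^ 2 * s / α := by
    calc pred ≤ 3 / 2 * lam * (√s * (3 / 2 * lam * √s / α)) := hpredle.trans (by gcongr)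
      _ = 9 / 4 * (lam ^ 2 * √(s : ℝ) ^ 2 / α) := by ring
      _ ≤ 32 * (lam ^ 2 * s / α) := by
        rw [hss]
        have : 0 ≤ lam ^ 2 * s / α := by positivity
        linarith
      _ = _ := by ring
  refine ⟨hF.trans ?_, hpredfin, le_trans ?_ hpredfin⟩
  · rw [div_le_div_iff_of_pos_right hα]
    nlinarith [mul_nonneg hlam.le hs0]
  · have : Δᵀ * empCov X * Δ = (1 / (T : ℝ)) • ((X * Δ)ᵀ * (X * Δ)) := by
      rw [empCov, Matrix.transpose_mul, Matrix.mul_smul, Matrix.smul_mul]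
      simp only [Matrix.mul_assoc]
    rw [this, frob_smul_of_nonneg hT0]
    exact mul_le_mul_of_nonneg_left (frob_transpose_mul_self_le _) hT0

/-! ### Linear functionals of a stationary Gaussian process -/

section Coefficients

variable {E : Type*} [MeasurableSpace E] {Z : ℕ → Ω → E}

lemma alphaDep_le_alphaCoef [IsProbabilityMeasure μ] (t l : ℕ) :
    alphaDep μ (pastSigma Z t) (futureSigma Z (t + l)) ≤ alphaCoef Z μ l :=
  le_ciSup (f := fun t ↦ alphaDep μ (pastSigma Z t) (futureSigma Z (t + l)))
    ⟨1, by rintro _ ⟨t, rfl⟩; exact alphaDep_le_one⟩ t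

lemma alphaCoef_nonneg [IsProbabilityMeasure μ] (l : ℕ) : 0 ≤ alphaCoef Z μ l :=
  alphaDep_nonneg.trans (alphaDep_le_alphaCoef 0 l)

lemma alphaSum_nonneg [IsProbabilityMeasure μ] (T : ℕ) : 0 ≤ alphaSum Z μ T :=
  Finset.sum_nonneg fun _ _ ↦ alphaCoef_nonneg _

/-- Each value of `|s - t|` is attained at most twice. The truncated differences add up
to `|s - t|`. -/
lemma sum_alphaCoef_le [IsProbabilityMeasure μ] {T s : ℕ} (hs : s < T) :
    ∑ t ∈ Finset.range T, alphaCoef Z μ ((s - t) + (t - s)) ≤ 2 * alphaSum Z μ T := by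
  have key : ∀ (A : Finset ℕ) (f : ℕ → ℕ), Set.InjOn f A → (∀ t ∈ A, f t < T + 1) →
      ∑ t ∈ A, alphaCoef Z μ (f t) ≤ alphaSum Z μ T := by
    intro A f hf hA
    rw [← Finset.sum_image (f := fun l ↦ alphaCoef Z μ l) hf]
    refine Finset.sum_le_sum_of_subset_of_nonneg ?_ fun _ _ _ ↦ alphaCoef_nonneg _
    intro l hl
    obtain ⟨t, ht, rfl⟩ := Finset.mem_image.1 hl
    exact Finset.mem_range.2 (hA t ht)
  rw [← Finset.sum_filter_add_sum_filter_not _ (fun t ↦ t ≤ s), two_mul]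
  refine add_le_add (key _ _ ?_ ?_) (key _ _ ?_ ?_)
  · intro t ht t' ht' h
    simp only [Finset.coe_filter, Finset.mem_range, Set.mem_ofPred_eq] at ht ht' h
    omega
  · intro t ht
    simp only [Finset.mem_filter, Finset.mem_range] at ht
    omega
  · intro t ht t' ht' h
    simp only [Finset.coe_filter, Finset.mem_range, Set.mem_ofPred_eq] at ht ht' h
    omega
  · intro t ht
    simp only [Finset.mem_filter, Finset.mem_range] at ht
    omega

lemma StrictlyStationary.identDistrib (h : StrictlyStationary Z μ) (t : ℕ) :
    IdentDistrib (Z t) (Z 0) μ μ := by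
  have := (h 0 t 0).comp (u := fun z : Fin 1 → E ↦ z 0) (measurable_pi_apply 0)
  simpa [Function.comp_def] using this.symm

end Coefficients

/-- A row sum bound for symmetric quadratic forms. -/
lemma sum_mul_mul_le_of_row_sum_le {ι : Type*} [Fintype ι] {K : ι → ι → ℝ}
    (hK : ∀ i j, K i j = K j i) {M : ℝ} (hM : ∀ i, ∑ j, |K i j| ≤ M) (x : ι → ℝ) :
    ∑ i, ∑ j, x i * x j * K i j ≤ M * ∑ i, x i ^ 2 := by
  have h1 : ∀ i j, x i * x j * K i j ≤ (x i ^ 2 * |K i j|) / 2 + (x j ^ 2 * |K i j|) / 2 := by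
    intro i j
    have h2 : x i * x j * K i j ≤ |x i * x j| * |K i j| := by
      rw [← abs_mul]; exact le_abs_self _
    have h3 : |x i * x j| ≤ (x i ^ 2 + x j ^ 2) / 2 := by
      rw [abs_le]
      constructor <;> nlinarith [sq_nonneg (x i + x j), sq_nonneg (x i - x j)]
    nlinarith [mul_le_mul_of_nonneg_right h3 (abs_nonneg (K i j))]
  calc ∑ i, ∑ j, x i * x j * K i j
      ≤ ∑ i, ∑ j, ((x i ^ 2 * |K i j|) / 2 + (x j ^ 2 * |K i j|) / 2) :=
        Finset.sum_le_sum fun i _ ↦ Finset.sum_le_sum fun j _ ↦ h1 i j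
    _ = ∑ i, x i ^ 2 * ∑ j, |K i j| := by
        simp only [Finset.sum_add_distrib]
        conv_lhs => rw [Finset.sum_comm (f := fun i j ↦ (x j ^ 2 * |K i j|) / 2)]
        rw [← Finset.sum_add_distrib]
        refine Finset.sum_congr rfl fun i _ ↦ ?_
        rw [← Finset.sum_add_distrib, Finset.mul_sum]
        refine Finset.sum_congr rfl fun j _ ↦ ?_
        rw [hK j i]; ring
    _ ≤ ∑ i, x i ^ 2 * M :=
        Finset.sum_le_sum fun i _ ↦ mul_le_mul_of_nonneg_left (hM i) (sq_nonneg _)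
    _ = _ := by rw [← Finset.sum_mul, mul_comm]

section Functional

variable {E : Type*} [NormedAddCommGroup E] [NormedSpace ℝ E] [MeasurableSpace E] [BorelSpace E]
  [SecondCountableTopology E]
  {Z : ℕ → Ω → E}

lemma functional_hasGaussianLaw (hZ : IsGaussianProcess Z μ)
    (L : E →L[ℝ] ℝ) (T : ℕ) : HasGaussianLaw (fun ω (i : Fin T) ↦ L (Z i ω)) μ := by
  have h := (hZ.comp_left (fun _ ↦ L)).hasGaussianLaw (Finset.range T)
  exact h.map_fun (ContinuousLinearMap.pi fun i : Fin T ↦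
    ContinuousLinearMap.proj (R := ℝ) (φ := fun _ : Finset.range T ↦ ℝ)
      ⟨i, Finset.mem_range.2 i.2⟩)

/-- The autocovariance of a linear functional of the process is bounded by the mixing coefficient
at the time lag `|s - t| = (s - t) + (t - s)`. -/
lemma functional_covariance_le
    (hZ : IsGaussianProcess Z μ)
    (hm : ∀ t, Measurable (Z t)) (hst : StrictlyStationary Z μ) (L : E →L[ℝ] ℝ)
    (h0 : ∀ t, ∫ ω, L (Z t ω) ∂μ = 0) (s t : ℕ) :
    orthantConst * |cov[fun ω ↦ L (Z s ω), fun ω ↦ L (Z t ω); μ]| ≤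
      alphaCoef Z μ ((s - t) + (t - s)) * Var[fun ω ↦ L (Z 0 ω); μ] := by
  have hP := hZ.isProbabilityMeasure
  wlog hle : s ≤ t generalizing s t
  · rw [covariance_comm, add_comm]
    exact this t s (by omega)
  obtain ⟨l, rfl⟩ := Nat.exists_eq_add_of_le hle
  have hvar : ∀ t, Var[fun ω ↦ L (Z t ω); μ] = Var[fun ω ↦ L (Z 0 ω); μ] := fun t ↦
    ((hst.identDistrib t).comp L.continuous.measurable).variance_eq
  have hpast : pastSigma Z s ≤ mΩ := iSup_le fun u ↦ (hm u).comap_le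
  have hfut : futureSigma Z (s + l) ≤ mΩ := iSup_le fun u ↦ (hm u).comap_le
  have hmp : Measurable[pastSigma Z s] fun ω ↦ L (Z s ω) :=
    L.continuous.measurable.comp ((comap_measurable (Z s)).mono
      (le_iSup (fun u : Set.Iic s ↦ MeasurableSpace.comap (Z u) inferInstance) ⟨s, by simp⟩) le_rfl)
  have hmf : Measurable[futureSigma Z (s + l)] fun ω ↦ L (Z (s + l) ω) :=
    L.continuous.measurable.comp ((comap_measurable (Z (s + l))).mono
      (le_iSup (fun u : Set.Ici (s + l) ↦ MeasurableSpace.comap (Z u) inferInstance)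
        ⟨s + l, by simp⟩) le_rfl)
  have hg : HasGaussianLaw (fun ω ↦ (L (Z s ω), L (Z (s + l) ω))) μ :=
    (hZ.comp_left (fun _ ↦ L)).hasGaussianLaw_prodMk
  have h := orthantConst_mul_abs_covariance_le hpast hfut hg hmp hmf (h0 s) (h0 (s + l))
  rw [hvar s, hvar (s + l), Real.mul_self_sqrt (variance_nonneg _ _)] at h
  refine h.trans ?_
  have hl : s - (s + l) + (s + l - s) = l := by omega
  rw [hl]
  exact mul_le_mul_of_nonneg_right (alphaDep_le_alphaCoef s l) (variance_nonneg _ _)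

/-- Concentration of the empirical second moment of a linear functional of a stationary Gaussian
process, with the sum of the `α` coefficients as variance proxy. -/
theorem empirical_variance_tail
    (hZ : IsGaussianProcess Z μ)
    (hm : ∀ t, Measurable (Z t)) (hst : StrictlyStationary Z μ) (L : E →L[ℝ] ℝ)
    (h0 : ∀ t, ∫ ω, L (Z t ω) ∂μ = 0) {V : ℝ} (hV : Var[fun ω ↦ L (Z 0 ω); μ] ≤ V)
    {T : ℕ} (hT : 0 < T) {M : ℝ} (hM : 0 < M) (hMV : 2 * V * alphaSum Z μ T ≤ orthantConst * M)
    {u : ℝ} (hu : 0 ≤ u) :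
    μ.real {ω | M * u ≤ |1 / (T : ℝ) * ∑ t : Fin T, L (Z t ω) ^ 2 - Var[fun ω ↦ L (Z 0 ω); μ]|}
      ≤ 2 * Real.exp (-(T * min u (u ^ 2) / 16)) := by
  have hP := hZ.isProbabilityMeasure
  have hvar : ∀ t, Var[fun ω ↦ L (Z t ω); μ] = Var[fun ω ↦ L (Z 0 ω); μ] := fun t ↦
    ((hst.identDistrib t).comp L.continuous.measurable).variance_eq
  have hκ := orthantConst_pos
  have hS := alphaSum_nonneg (Z := Z) (μ := μ) T
  have hK := sum_mul_mul_le_of_row_sum_le (M := M)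
    (K := fun i j : Fin T ↦ cov[fun ω ↦ L (Z i ω), fun ω ↦ L (Z j ω); μ])
    (fun i j ↦ covariance_comm _ _) (by
      intro i
      refine le_of_mul_le_mul_left ?_ hκ
      refine le_trans ?_ hMV
      rw [Finset.mul_sum]
      calc _ ≤ ∑ j : Fin T, alphaCoef Z μ (((i : ℕ) - j) + (j - i)) * V :=
            Finset.sum_le_sum fun j _ ↦
              (functional_covariance_le hZ hm hst L h0 i j).trans
                (mul_le_mul_of_nonneg_left hV (alphaCoef_nonneg _))
        _ = (∑ t ∈ Finset.range T, alphaCoef Z μ (((i : ℕ) - t) + (t - i))) * V := by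
            rw [← Finset.sum_mul, Finset.sum_range]
        _ ≤ 2 * alphaSum Z μ T * V :=
            mul_le_mul_of_nonneg_right (sum_alphaCoef_le i.2) ((variance_nonneg _ _).trans hV)
        _ = _ := by ring)
  have h := sum_sq_tail_of_gaussian (G := fun (i : Fin T) ω ↦ L (Z i ω))
    (functional_hasGaussianLaw hZ L T) (fun i ↦ L.continuous.measurable.comp (hm i))
    (fun i ↦ h0 i) hM hK hu
  rw [Fintype.card_fin] at h
  refine le_trans (measureReal_mono fun ω hω ↦ ?_) h
  have hT' : (0 : ℝ) < T := by exact_mod_cast hT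
  simp only [Set.mem_ofPred_eq, hvar, Finset.sum_sub_distrib, Finset.sum_const, Finset.card_univ,
    Fintype.card_fin, nsmul_eq_mul] at hω ⊢
  set v := Var[fun ω ↦ L (Z 0 ω); μ]
  calc T * M * u = T * (M * u) := by ring
    _ ≤ T * |1 / (T : ℝ) * ∑ t : Fin T, L (Z t ω) ^ 2 - v| := by gcongr
    _ = |∑ t : Fin T, L (Z t ω) ^ 2 - T * v| := by
      rw [← abs_of_pos hT', ← abs_mul, abs_of_pos hT']
      congr 1
      field_simp

end Functional

/-! ### Eigenvalue bounds and second moment matrices -/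

lemma dotProduct_mulVec_eq_sum_eigenvalues {n : ℕ} {M : Matrix (Fin n) (Fin n) ℝ}
    (hM : M.IsHermitian) (v : Fin n → ℝ) :
    v ⬝ᵥ M *ᵥ v = ∑ i, hM.eigenvalues i * (hM.eigenvectorBasis i ⬝ᵥ v) ^ 2 ∧
      v ⬝ᵥ v = ∑ i, (hM.eigenvectorBasis i ⬝ᵥ v) ^ 2 := by
  have hinner : ∀ x y : Fin n → ℝ,
      inner ℝ (WithLp.toLp 2 x : EuclideanSpace ℝ (Fin n)) (WithLp.toLp 2 y) = x ⬝ᵥ y := by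
    intro x y
    simp [PiLp.inner_apply, dotProduct, mul_comm]
  have hpars : ∀ x y : Fin n → ℝ, x ⬝ᵥ y
      = ∑ i, (hM.eigenvectorBasis i ⬝ᵥ x) * (hM.eigenvectorBasis i ⬝ᵥ y) := by
    intro x y
    rw [← hinner, ← hM.eigenvectorBasis.sum_inner_mul_inner]
    refine Finset.sum_congr rfl fun i _ ↦ ?_
    rw [real_inner_comm]
    exact congrArg₂ _ (hinner _ _) (hinner _ _)
  constructor
  · rw [hpars]
    refine Finset.sum_congr rfl fun i _ ↦ ?_
    have hsym : Mᵀ = M := (Matrix.conjTranspose_eq_transpose_of_trivial M).symm.trans hM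
    have : hM.eigenvectorBasis i ⬝ᵥ M *ᵥ v
        = hM.eigenvalues i * (hM.eigenvectorBasis i ⬝ᵥ v) := by
      rw [Matrix.dotProduct_mulVec, ← Matrix.mulVec_transpose, hsym, hM.mulVec_eigenvectorBasis,
        smul_dotProduct, smul_eq_mul]
    rw [this]; ring
  · rw [hpars]
    exact Finset.sum_congr rfl fun i _ ↦ (sq _).symm

lemma lambdaMin_mul_le {n : ℕ} {M : Matrix (Fin n) (Fin n) ℝ} (hM : M.IsHermitian)
    (v : Fin n → ℝ) : lambdaMin M * (v ⬝ᵥ v) ≤ v ⬝ᵥ M *ᵥ v := by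
  obtain ⟨h1, h2⟩ := dotProduct_mulVec_eq_sum_eigenvalues hM v
  rw [h1, h2, Finset.mul_sum]
  refine Finset.sum_le_sum fun i _ ↦ mul_le_mul_of_nonneg_right ?_ (sq_nonneg _)
  exact csInf_le (Matrix.finite_real_spectrum (A := M)).bddBelow
    (hM.eigenvalues_mem_spectrum_real i)

lemma le_lambdaMax_mul {n : ℕ} {M : Matrix (Fin n) (Fin n) ℝ} (hM : M.IsHermitian)
    (v : Fin n → ℝ) : v ⬝ᵥ M *ᵥ v ≤ lambdaMax M * (v ⬝ᵥ v) := by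
  obtain ⟨h1, h2⟩ := dotProduct_mulVec_eq_sum_eigenvalues hM v
  rw [h1, h2, Finset.mul_sum]
  refine Finset.sum_le_sum fun i _ ↦ mul_le_mul_of_nonneg_right ?_ (sq_nonneg _)
  exact le_csSup (Matrix.finite_real_spectrum (A := M)).bddAbove
    (hM.eigenvalues_mem_spectrum_real i)

lemma opNorm_nonneg {n : ℕ} (M : Matrix (Fin n) (Fin n) ℝ) : 0 ≤ opNorm M := norm_nonneg _

lemma diag_le_opNorm {n : ℕ} (M : Matrix (Fin n) (Fin n) ℝ) (i : Fin n) : M i i ≤ opNorm M := by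
  set e : EuclideanSpace ℝ (Fin n) := EuclideanSpace.single i 1 with he
  have hn : ‖e‖ = 1 := by simp [he]
  have h1 : inner ℝ e (Matrix.toEuclideanCLM (n := Fin n) (𝕜 := ℝ) M e) = M i i := by
    simp [he, PiLp.inner_apply]
  rw [← h1]
  refine (real_inner_le_norm _ _).trans ?_
  rw [hn, one_mul]
  refine (ContinuousLinearMap.le_opNorm _ _).trans ?_
  rw [hn, mul_one, opNorm]

lemma secondMoment_isHermitian {n : ℕ} (V : Ω → Fin n → ℝ) :
    (secondMoment V μ).IsHermitian := by
  ext i j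
  simp [secondMoment, mul_comm]

lemma dotProduct_secondMoment_mulVec {n : ℕ} {V : Ω → Fin n → ℝ}
    (hV : ∀ i, MemLp (fun ω ↦ V ω i) 2 μ) (v : Fin n → ℝ) :
    v ⬝ᵥ secondMoment V μ *ᵥ v = ∫ ω, (v ⬝ᵥ V ω) ^ 2 ∂μ := by
  have hint : ∀ i j, Integrable (fun ω ↦ v i * v j * (V ω i * V ω j)) μ := fun i j ↦
    ((hV i).integrable_mul (hV j)).const_mul _
  have h1 : ∀ ω, (v ⬝ᵥ V ω) ^ 2 = ∑ i, ∑ j, v i * v j * (V ω i * V ω j) := by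
    intro ω
    rw [sq, dotProduct, Finset.sum_mul_sum]
    exact Finset.sum_congr rfl fun i _ ↦ Finset.sum_congr rfl fun j _ ↦ by ring
  simp only [h1]
  rw [integral_finsetSum _ fun i _ ↦ integrable_finsetSum _ fun j _ ↦ hint i j]
  simp only [dotProduct, Matrix.mulVec, secondMoment, Matrix.of_apply, Finset.mul_sum]
  refine Finset.sum_congr rfl fun i _ ↦ ?_
  rw [integral_finsetSum _ fun j _ ↦ hint i j]
  refine Finset.sum_congr rfl fun j _ ↦ ?_
  rw [integral_const_mul]
  ring

lemma dotProduct_empCov_mulVec {p T : ℕ} (X : Matrix (Fin T) (Fin p) ℝ) (v : Fin p → ℝ) :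
    v ⬝ᵥ empCov X *ᵥ v = 1 / (T : ℝ) * ∑ t, (v ⬝ᵥ X t) ^ 2 := by
  rw [empCov, Matrix.smul_mulVec, dotProduct_smul, smul_eq_mul, ← Matrix.mulVec_mulVec,
    Matrix.dotProduct_mulVec, Matrix.vecMul_transpose]
  congr 1
  simp only [dotProduct, Matrix.mulVec, sq]
  exact Finset.sum_congr rfl fun t _ ↦ by
    congr 1 <;> exact Finset.sum_congr rfl fun i _ ↦ mul_comm _ _

lemma sum_dotProduct_empCov_mulVec {p q T : ℕ} (X : Matrix (Fin T) (Fin p) ℝ)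
    (Δ : Matrix (Fin p) (Fin q) ℝ) :
    ∑ j, Δᵀ j ⬝ᵥ empCov X *ᵥ Δᵀ j = 1 / (T : ℝ) * frob (X * Δ) ^ 2 := by
  simp only [dotProduct_empCov_mulVec, ← Finset.mul_sum, frob_sq]
  rw [Finset.sum_comm]
  congr 1
  refine Finset.sum_congr rfl fun t _ ↦ Finset.sum_congr rfl fun j _ ↦ ?_
  simp only [dotProduct, Matrix.mul_apply, Matrix.transpose_apply]
  congr 1
  exact Finset.sum_congr rfl fun i _ ↦ mul_comm _ _

lemma sum_dotProduct_transpose {p q : ℕ} (Δ : Matrix (Fin p) (Fin q) ℝ) :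
    ∑ j, Δᵀ j ⬝ᵥ Δᵀ j = frob Δ ^ 2 := by
  rw [frob_sq, Finset.sum_comm]
  simp only [dotProduct, Matrix.transpose_apply, sq]

/-! ### The restricted eigenvalue condition -/

/-- A covariance estimate that is accurate on all sums of `k` signed basis vectors satisfies the
restricted eigenvalue condition on the cone of `s`-sparse regression errors once `k > 32 s`. -/
theorem restricted_eigenvalue {p q T s k : ℕ} {X : Matrix (Fin T) (Fin p) ℝ}
    {Sig : Matrix (Fin p) (Fin p) ℝ} (hSig : Sig.IsHermitian) {lmin δ : ℝ} (hδ : 0 ≤ δ)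
    (hδl : 4 * δ ≤ lmin) (hmin : ∀ v, lmin * (v ⬝ᵥ v) ≤ v ⬝ᵥ Sig *ᵥ v)
    (hk : 32 * s + 1 ≤ k) (hk2 : 2 ≤ k)
    (hJ : ∀ J : Fin k → Fin p × Bool, |signedSum J ⬝ᵥ (empCov X - Sig) *ᵥ signedSum J|
      ≤ δ * (signedSum J ⬝ᵥ signedSum J))
    (Δ : Matrix (Fin p) (Fin q) ℝ) (hΔ : vecL1 Δ ^ 2 ≤ 16 * s * frob Δ ^ 2) :
    lmin / 2 * frob Δ ^ 2 ≤ 1 / (T : ℝ) * frob (X * Δ) ^ 2 := by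
  set D := empCov X - Sig with hD
  have hSigT : Sigᵀ = Sig := (Matrix.conjTranspose_eq_transpose_of_trivial Sig).symm.trans hSig
  have hsymm : (D + δ • 1).IsSymm := by
    rw [Matrix.IsSymm, hD]
    simp [empCov, hSigT]
  have hquad : ∀ v : Fin p → ℝ, v ⬝ᵥ (D + δ • 1) *ᵥ v = v ⬝ᵥ D *ᵥ v + δ * (v ⬝ᵥ v) := by
    intro v
    rw [Matrix.add_mulVec, dotProduct_add, Matrix.smul_mulVec, Matrix.one_mulVec, dotProduct_smul,
      smul_eq_mul]
  have hk0 : (0 : ℝ) < k := by exact_mod_cast (by omega : 0 < k)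
  -- the constant choice of indices tests the diagonal entries
  have hdiag : ∀ i, (D + δ • 1) i i ≤ 2 * δ := by
    intro i
    have h1 := hJ fun _ ↦ (i, true)
    have h2 : signedSum (fun _ : Fin k ↦ (i, true)) = (k : ℝ) • Pi.single i 1 := by
      simp [signedSum, ← Nat.cast_smul_eq_nsmul ℝ]
    rw [h2, Matrix.mulVec_smul, smul_dotProduct, dotProduct_smul, smul_dotProduct,
      dotProduct_smul] at h1
    simp only [Matrix.mulVec_single_one, single_one_dotProduct, smul_eq_mul, Pi.single_eq_same,
      Matrix.col_apply, mul_one] at h1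
    have h3 := (abs_le.1 h1).2
    have h4 : (k : ℝ) * (k * D i i) ≤ k * (k * δ) := by linarith
    have h5 := le_of_mul_le_mul_left (le_of_mul_le_mul_left h4 hk0) hk0
    simp only [Matrix.add_apply, Matrix.smul_apply, Matrix.one_apply_eq, smul_eq_mul, mul_one]
    linarith
  have hlow : ∀ v : Fin p → ℝ, ((k : ℝ) - 1) * ((lmin - δ) * (v ⬝ᵥ v))
      ≤ ((k : ℝ) - 1) * (v ⬝ᵥ empCov X *ᵥ v) + 2 * δ * (∑ i, |v i|) ^ 2 := by
    intro v
    have h1 := quadratic_lower_of_signedSum hsymm (by omega : 1 ≤ k) (fun J ↦ by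
      rw [hquad]
      have := (abs_le.1 (hJ J)).1
      linarith) hdiag v
    rw [hquad, hD, Matrix.sub_mulVec, dotProduct_sub] at h1
    have hk1 : (0 : ℝ) ≤ (k : ℝ) - 1 := by
      have : (1 : ℝ) ≤ k := by exact_mod_cast (by omega : 1 ≤ k)
      linarith
    nlinarith [mul_le_mul_of_nonneg_left (hmin v) hk1]
  have hsum := Finset.sum_le_sum fun j (_ : j ∈ Finset.univ) ↦ hlow (Δᵀ j)
  rw [Finset.sum_add_distrib] at hsum
  simp only [← Finset.mul_sum, sum_dotProduct_empCov_mulVec, sum_dotProduct_transpose] at hsum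
  have hl1 : ∑ j, (∑ i, |Δᵀ j i|) ^ 2 ≤ vecL1 Δ ^ 2 := by
    have : vecL1 Δ = ∑ j, ∑ i, |Δᵀ j i| := by
      rw [vecL1, Finset.sum_comm]; rfl
    rw [this]
    exact Finset.sum_sq_le_sq_sum_of_nonneg fun j _ ↦ Finset.sum_nonneg fun i _ ↦ abs_nonneg _
  have hks : 32 * (s : ℝ) ≤ (k : ℝ) - 1 := by
    have : (32 * s + 1 : ℝ) ≤ k := by exact_mod_cast hk
    linarith
  have hk1 : (0 : ℝ) < (k : ℝ) - 1 := by
    have : (2 : ℝ) ≤ k := by exact_mod_cast hk2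
    linarith
  have hF := sq_nonneg (frob Δ)
  have h3 : 2 * δ * ∑ j, (∑ i, |Δᵀ j i|) ^ 2 ≤ ((k : ℝ) - 1) * (δ * frob Δ ^ 2) := by
    calc 2 * δ * ∑ j, (∑ i, |Δᵀ j i|) ^ 2 ≤ 2 * δ * (16 * s * frob Δ ^ 2) := by
          gcongr; exact hl1.trans hΔ
      _ = 32 * s * (δ * frob Δ ^ 2) := by ring
      _ ≤ _ := by gcongr
  refine le_of_mul_le_mul_left ?_ hk1
  have h4 : 0 ≤ ((k : ℝ) - 1) * ((lmin - 4 * δ) * frob Δ ^ 2) :=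
    mul_nonneg hk1.le (mul_nonneg (by linarith) hF)
  nlinarith

/-! ### Population least squares -/

section Residual

variable {p q : ℕ} {U : Ω → Fin p → ℝ} {V : Ω → Fin q → ℝ} {Θ : Matrix (Fin p) (Fin q) ℝ}

lemma memLp_residual (hU : ∀ i, MemLp (fun ω ↦ U ω i) 2 μ) (hV : ∀ j, MemLp (fun ω ↦ V ω j) 2 μ)
    (j : Fin q) : MemLp (fun ω ↦ V ω j - (Θᵀ *ᵥ U ω) j) 2 μ := by
  refine (hV j).sub ?_
  simp only [Matrix.mulVec, dotProduct]
  exact memLp_finsetSum _ fun i _ ↦ (hU i).const_mul _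

/-- The normal equations of the population least squares problem. -/
lemma integral_mul_residual_eq_zero (hU : ∀ i, MemLp (fun ω ↦ U ω i) 2 μ)
    (hV : ∀ j, MemLp (fun ω ↦ V ω j) 2 μ) (hΘ : IsMinOn (populationRisk U V μ) Set.univ Θ)
    (i : Fin p) (j : Fin q) : ∫ ω, U ω i * (V ω j - (Θᵀ *ᵥ U ω) j) ∂μ = 0 := by
  set W : Ω → Fin q → ℝ := fun ω j ↦ V ω j - (Θᵀ *ᵥ U ω) j with hW
  have hWL : ∀ j, MemLp (fun ω ↦ W ω j) 2 μ := memLp_residual hU hV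
  set a := ∫ ω, U ω i * W ω j ∂μ with ha
  set d := ∫ ω, U ω i ^ 2 ∂μ with hd
  have hd0 : 0 ≤ d := integral_nonneg fun ω ↦ sq_nonneg _
  have hi1 : Integrable (fun ω ↦ ∑ j, W ω j ^ 2) μ :=
    integrable_finsetSum _ fun j _ ↦ (hWL j).integrable_sq
  have hi2 : Integrable (fun ω ↦ U ω i * W ω j) μ := (hU i).integrable_mul (hWL j)
  have hi3 : Integrable (fun ω ↦ U ω i ^ 2) μ := (hU i).integrable_sq
  have hrisk : ∀ t : ℝ, populationRisk U V μ (Θ + Matrix.single i j t)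
      = populationRisk U V μ Θ - 2 * t * a + t ^ 2 * d := by
    intro t
    have hpt : ∀ ω, ∑ l, (V ω l - ((Θ + Matrix.single i j t)ᵀ *ᵥ U ω) l) ^ 2
        = ∑ l, W ω l ^ 2 - 2 * t * (U ω i * W ω j) + t ^ 2 * U ω i ^ 2 := by
      intro ω
      have h1 : ∀ l, V ω l - ((Θ + Matrix.single i j t)ᵀ *ᵥ U ω) l
          = W ω l - if l = j then t * U ω i else 0 := by
        intro l
        rw [Matrix.transpose_add, Matrix.add_mulVec, Matrix.transpose_single, Pi.add_apply, hW,
          Matrix.single_mulVec]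
        by_cases h : l = j
        · subst h; simp; ring
        · simp [h, Function.update_of_ne]
      have h2 : ∀ l, (V ω l - ((Θ + Matrix.single i j t)ᵀ *ᵥ U ω) l) ^ 2
          = W ω l ^ 2 + if l = j then t ^ 2 * U ω i ^ 2 - 2 * t * (U ω i * W ω j) else 0 := by
        intro l
        rw [h1]
        split_ifs with h
        · subst h; ring
        · ring
      simp only [h2, Finset.sum_add_distrib, Finset.sum_ite_eq', Finset.mem_univ, if_true]
      ring
    have hi12 : Integrable (fun ω ↦ ∑ l, W ω l ^ 2 - 2 * t * (U ω i * W ω j)) μ :=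
      hi1.sub (hi2.const_mul _)
    simp only [populationRisk, hpt]
    rw [integral_add hi12 (hi3.const_mul _),
      integral_sub hi1 (hi2.const_mul _), integral_const_mul, integral_const_mul]
  have hmin : ∀ t : ℝ, 0 ≤ t ^ 2 * d - 2 * t * a := by
    intro t
    have h1 : populationRisk U V μ Θ ≤ populationRisk U V μ (Θ + Matrix.single i j t) :=
      hΘ (Set.mem_univ _)
    rw [hrisk] at h1
    linarith
  -- a step in the direction of the gradient would decrease the risk
  by_contra hne
  have h1 := hmin (a / (d + 1))
  have h2 : (a / (d + 1)) ^ 2 * d - 2 * (a / (d + 1)) * a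
      = -(a ^ 2 * (d + 2)) / (d + 1) ^ 2 := by
    field_simp
    ring
  have h3 : 0 < a ^ 2 := by positivity
  rw [h2, neg_div] at h1
  have : 0 < a ^ 2 * (d + 2) / (d + 1) ^ 2 := by positivity
  linarith

lemma integral_residual_sq_le (hU : ∀ i, MemLp (fun ω ↦ U ω i) 2 μ)
    (hV : ∀ j, MemLp (fun ω ↦ V ω j) 2 μ) (hΘ : IsMinOn (populationRisk U V μ) Set.univ Θ)
    (j : Fin q) : ∫ ω, (V ω j - (Θᵀ *ᵥ U ω) j) ^ 2 ∂μ ≤ ∫ ω, V ω j ^ 2 ∂μ := by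
  set W : Ω → ℝ := fun ω ↦ V ω j - (Θᵀ *ᵥ U ω) j with hW
  have hWL : MemLp W 2 μ := memLp_residual hU hV j
  have hint : ∀ i, Integrable (fun ω ↦ Θ i j * (U ω i * W ω)) μ := fun i ↦
    ((hU i).integrable_mul hWL).const_mul _
  have hzero : ∫ ω, ∑ i, Θ i j * (U ω i * W ω) ∂μ = 0 := by
    rw [integral_finsetSum _ fun i _ ↦ hint i]
    refine Finset.sum_eq_zero fun i _ ↦ ?_
    rw [integral_const_mul, integral_mul_residual_eq_zero hU hV hΘ, mul_zero]
  have hle : ∫ ω, (W ω ^ 2 + 2 * ∑ i, Θ i j * (U ω i * W ω)) ∂μ ≤ ∫ ω, V ω j ^ 2 ∂μ := by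
    refine integral_mono (hWL.integrable_sq.add
      ((integrable_finsetSum _ fun i _ ↦ hint i).const_mul 2)) (hV j).integrable_sq fun ω ↦ ?_
    have h1 : ∑ i, Θ i j * (U ω i * W ω) = (Θᵀ *ᵥ U ω) j * W ω := by
      simp only [Matrix.mulVec, dotProduct, Matrix.transpose_apply, Finset.sum_mul]
      exact Finset.sum_congr rfl fun i _ ↦ by ring
    have h2 : V ω j = W ω + (Θᵀ *ᵥ U ω) j := by simp [hW]
    simp only [h1]
    rw [h2]
    nlinarith [sq_nonneg ((Θᵀ *ᵥ U ω) j)]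
  rwa [integral_add hWL.integrable_sq ((integrable_finsetSum _ fun i _ ↦ hint i).const_mul 2),
    integral_const_mul, hzero, mul_zero, add_zero] at hle

end Residual

/-! ### Tail bounds for the empirical covariance and the score -/

/-- Up to scaling, the sums of `k` signed basis vectors form a set of at most `(2p)^k` vectors; in
dimension one, of a single vector. -/
lemma exists_test_vectors {p : ℕ} (hp : 1 ≤ p) (k : ℕ) {x : ℝ} (hx0 : 0 ≤ x)
    (hx : 2 ≤ p → k * Real.log (2 * p) ≤ x) :
    ∃ F : Finset (Fin p → ℝ), (F.card : ℝ) ≤ Real.exp x ∧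
      ∀ (D : Matrix (Fin p) (Fin p) ℝ) (δ : ℝ), (∀ v ∈ F, |v ⬝ᵥ D *ᵥ v| ≤ δ * (v ⬝ᵥ v)) →
        ∀ J : Fin k → Fin p × Bool, |signedSum J ⬝ᵥ D *ᵥ signedSum J|
          ≤ δ * (signedSum J ⬝ᵥ signedSum J) := by
  classical
  rcases hp.eq_or_lt with rfl | hp2
  · refine ⟨{fun _ ↦ 1}, by simpa using hx0, fun D δ h J ↦ ?_⟩
    have h1 := h _ (Finset.mem_singleton_self _)
    -- in dimension one all sums of signed basis vectors are multiples of the vector `1`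
    set c := signedSum J 0 with hc
    have hJ : signedSum J = c • fun _ ↦ (1 : ℝ) := by
      ext i
      rw [Subsingleton.elim i 0]
      simp [hc]
    rw [hJ, Matrix.mulVec_smul, smul_dotProduct, dotProduct_smul, smul_dotProduct,
      dotProduct_smul]
    simp only [smul_eq_mul]
    rw [← mul_assoc, ← mul_assoc, abs_mul, abs_mul_self]
    nlinarith [mul_le_mul_of_nonneg_left h1 (mul_self_nonneg c)]
  · refine ⟨Finset.univ.image signedSum, ?_, fun D δ h J ↦
      h _ (Finset.mem_image_of_mem _ (Finset.mem_univ J))⟩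
    have h2p : (0 : ℝ) < 2 * p := by
      have : (0 : ℝ) < p := by exact_mod_cast hp
      linarith
    calc ((Finset.univ.image (signedSum (ι := Fin p) (k := k))).card : ℝ)
        ≤ (Fintype.card (Fin k → Fin p × Bool) : ℝ) := by exact_mod_cast Finset.card_image_le
      _ = Real.exp (k * Real.log (2 * p)) := by
        rw [Real.exp_nat_mul, Real.exp_log h2p]
        simp [mul_comm]
      _ ≤ Real.exp x := Real.exp_le_exp.2 (hx hp2)

/-- The functional `(x, y) ↦ a · x + b · y`. -/
noncomputable def pairFunctional {p q : ℕ} (a : Fin p → ℝ) (b : Fin q → ℝ) :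
    (Fin p → ℝ) × (Fin q → ℝ) →L[ℝ] ℝ :=
  LinearMap.toContinuousLinearMap
    { toFun := fun z ↦ a ⬝ᵥ z.1 + b ⬝ᵥ z.2
      map_add' := fun z w ↦ by simp only [Prod.fst_add, Prod.snd_add, dotProduct_add]; ring
      map_smul' := fun c z ↦ by
        simp only [Prod.smul_fst, Prod.smul_snd, dotProduct_smul, smul_eq_mul, RingHom.id_apply]
        ring }

lemma pairFunctional_apply {p q : ℕ} (a : Fin p → ℝ) (b : Fin q → ℝ) (x : Fin p → ℝ)
    (y : Fin q → ℝ) : pairFunctional a b (x, y) = a ⬝ᵥ x + b ⬝ᵥ y := rfl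

lemma transpose_mul_residual_apply {p q T : ℕ} (X : Matrix (Fin T) (Fin p) ℝ)
    (Y : Matrix (Fin T) (Fin q) ℝ) (Θ : Matrix (Fin p) (Fin q) ℝ) (i : Fin p) (j : Fin q) :
    (Xᵀ * (Y - X * Θ)) i j = ∑ t, X t i * (Y t j - (Θᵀ *ᵥ X t) j) := by
  simp only [Matrix.mul_apply, Matrix.transpose_apply, Matrix.sub_apply, Matrix.mulVec, dotProduct]
  exact Finset.sum_congr rfl fun t _ ↦ by
    congr 2; exact Finset.sum_congr rfl fun l _ ↦ mul_comm _ _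

section Score

variable {p q : ℕ} {X : ℕ → Ω → Fin p → ℝ} {Y : ℕ → Ω → Fin q → ℝ}

lemma memLp_fst_apply (hZ : IsGaussianProcess (fun t ω ↦ (X t ω, Y t ω)) μ) (t : ℕ) (i : Fin p) :
    MemLp (fun ω ↦ X t ω i) 2 μ :=
  ((hZ.hasGaussianLaw_eval t).fst.map_fun (ContinuousLinearMap.proj i)).memLp_two

lemma memLp_snd_apply (hZ : IsGaussianProcess (fun t ω ↦ (X t ω, Y t ω)) μ) (t : ℕ) (j : Fin q) :
    MemLp (fun ω ↦ Y t ω j) 2 μ :=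
  ((hZ.hasGaussianLaw_eval t).snd.map_fun (ContinuousLinearMap.proj j)).memLp_two

lemma integral_pairFunctional (hZ : IsGaussianProcess (fun t ω ↦ (X t ω, Y t ω)) μ)
    (hX0 : ∀ t i, ∫ ω, X t ω i ∂μ = 0) (hY0 : ∀ t j, ∫ ω, Y t ω j ∂μ = 0)
    (a : Fin p → ℝ) (b : Fin q → ℝ) (t : ℕ) :
    ∫ ω, pairFunctional a b (X t ω, Y t ω) ∂μ = 0 := by
  have hP := hZ.isProbabilityMeasure
  have h1 : ∀ i, Integrable (fun ω ↦ a i * X t ω i) μ := fun i ↦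
    ((memLp_fst_apply hZ t i).integrable (by norm_num)).const_mul _
  have h2 : ∀ j, Integrable (fun ω ↦ b j * Y t ω j) μ := fun j ↦
    ((memLp_snd_apply hZ t j).integrable (by norm_num)).const_mul _
  simp only [pairFunctional_apply, dotProduct]
  rw [integral_add (integrable_finsetSum _ fun i _ ↦ h1 i) (integrable_finsetSum _ fun i _ ↦ h2 i),
    integral_finsetSum _ fun i _ ↦ h1 i, integral_finsetSum _ fun j _ ↦ h2 j]
  simp [integral_const_mul, hX0, hY0]

/-- Accuracy of the empirical covariance matrix in a fixed direction. -/
theorem empCov_quadratic_tail (hZ : IsGaussianProcess (fun t ω ↦ (X t ω, Y t ω)) μ)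
    (hXm : ∀ t, Measurable (X t)) (hYm : ∀ t, Measurable (Y t))
    (hst : StrictlyStationary (fun t ω ↦ (X t ω, Y t ω)) μ)
    (hX0 : ∀ t i, ∫ ω, X t ω i ∂μ = 0) (hY0 : ∀ t j, ∫ ω, Y t ω j ∂μ = 0)
    {T : ℕ} (hT : 0 < T) {δ ε : ℝ} (hδ : 0 < δ) (hε : 0 < ε)
    (hδε : 2 * lambdaMax (secondMoment (X 0) μ) * alphaSum (fun t ω ↦ (X t ω, Y t ω)) μ T * ε
      ≤ orthantConst * δ) (v : Fin p → ℝ) :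
    μ.real {ω | ¬ |v ⬝ᵥ (empCov (dataMatrix X T ω) - secondMoment (X 0) μ) *ᵥ v| ≤ δ * (v ⬝ᵥ v)}
      ≤ 2 * Real.exp (-(T * min ε (ε ^ 2) / 16)) := by
  have hP := hZ.isProbabilityMeasure
  rcases eq_or_ne v 0 with rfl | hv
  · simp only [zero_dotProduct, abs_zero, mul_zero, le_refl, not_true_eq_false, Set.ofPred_false,
      measureReal_empty]
    positivity
  have hvv : 0 < v ⬝ᵥ v := by
    rcases (Finset.sum_nonneg fun i _ ↦ mul_self_nonneg (v i) : 0 ≤ v ⬝ᵥ v).eq_or_lt with h | h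
    · exact absurd (dotProduct_self_eq_zero.1 h.symm) hv
    · exact h
  have hZm : ∀ t, Measurable fun ω ↦ (X t ω, Y t ω) := fun t ↦ (hXm t).prodMk (hYm t)
  have h0 := integral_pairFunctional hZ hX0 hY0 v 0
  have hvar : Var[fun ω ↦ pairFunctional v (0 : Fin q → ℝ) (X 0 ω, Y 0 ω); μ]
      = v ⬝ᵥ secondMoment (X 0) μ *ᵥ v := by
    have hm : Measurable fun ω ↦ pairFunctional v (0 : Fin q → ℝ) (X 0 ω, Y 0 ω) :=
      (pairFunctional v 0).continuous.measurable.comp (hZm 0)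
    rw [variance_of_integral_eq_zero hm.aemeasurable (h0 0),
      dotProduct_secondMoment_mulVec (memLp_fst_apply hZ 0)]
    simp [pairFunctional_apply]
  have h := empirical_variance_tail hZ hZm hst (pairFunctional v 0) h0
    (hvar.le.trans (le_lambdaMax_mul (secondMoment_isHermitian (X 0)) v)) hT
    (M := δ * (v ⬝ᵥ v) / ε) (by positivity) (by
      rw [mul_div_assoc', le_div_iff₀ hε]
      nlinarith [mul_le_mul_of_nonneg_right hδε hvv.le]) hε.le
  rw [hvar] at h
  refine (measureReal_mono fun ω hω ↦ ?_).trans h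
  simp only [Set.mem_ofPred_eq, not_le, Matrix.sub_mulVec, dotProduct_sub,
    dotProduct_empCov_mulVec, pairFunctional_apply, zero_dotProduct, add_zero] at hω ⊢
  rw [div_mul_cancel₀ _ hε.ne']
  exact hω.le

/-- The score `X'(Y - XΘ)/T` is small entrywise, by polarization of `X_i W_j` into the squares of
`X_i ± W_j`, where `W` is the residual of the population regression. -/
theorem score_tail (hZ : IsGaussianProcess (fun t ω ↦ (X t ω, Y t ω)) μ)
    (hXm : ∀ t, Measurable (X t)) (hYm : ∀ t, Measurable (Y t))
    (hst : StrictlyStationary (fun t ω ↦ (X t ω, Y t ω)) μ)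
    (hX0 : ∀ t i, ∫ ω, X t ω i ∂μ = 0) (hY0 : ∀ t j, ∫ ω, Y t ω j ∂μ = 0)
    {Θ : Matrix (Fin p) (Fin q) ℝ}
    (hΘ : IsMinOn (populationRisk (X 0) (Y 0) μ) Set.univ Θ)
    {T : ℕ} (hT : 0 < T) {M u : ℝ} (hM : 0 < M) (hu : 0 ≤ u)
    (hMV : 2 * (opNorm (secondMoment (X 0) μ) + opNorm (secondMoment (Y 0) μ))
      * alphaSum (fun t ω ↦ (X t ω, Y t ω)) μ T ≤ orthantConst * M) (i : Fin p) (j : Fin q) :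
    μ.real {ω | ¬ |1 / (T : ℝ) * ((dataMatrix X T ω)ᵀ *
        (dataMatrix Y T ω - dataMatrix X T ω * Θ)) i j| ≤ M * u / 2}
      ≤ 4 * Real.exp (-(T * min u (u ^ 2) / 16)) := by
  have hP := hZ.isProbabilityMeasure
  have hZm : ∀ t, Measurable fun ω ↦ (X t ω, Y t ω) := fun t ↦ (hXm t).prodMk (hYm t)
  have hLX := memLp_fst_apply hZ 0
  have hLY := memLp_snd_apply hZ 0
  set W : ℕ → Ω → ℝ := fun t ω ↦ Y t ω j - (Θᵀ *ᵥ X t ω) j with hW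
  have hLW : MemLp (W 0) 2 μ := memLp_residual hLX hLY j
  set L : ℝ → (Fin p → ℝ) × (Fin q → ℝ) →L[ℝ] ℝ := fun ε ↦
    pairFunctional (Pi.single i 1 - ε • Θᵀ j) (ε • Pi.single j 1) with hL
  have hLapp : ∀ ε t ω, L ε (X t ω, Y t ω) = X t ω i + ε * W t ω := by
    intro ε t ω
    simp only [hL, hW, pairFunctional_apply, sub_dotProduct, smul_dotProduct,
      single_one_dotProduct, smul_eq_mul, Matrix.mulVec]
    ring
  have h0 : ∀ ε t, ∫ ω, L ε (X t ω, Y t ω) ∂μ = 0 := fun ε t ↦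
    integral_pairFunctional hZ hX0 hY0 _ _ t
  set vX := ∫ ω, X 0 ω i ^ 2 ∂μ with hvX
  set vW := ∫ ω, W 0 ω ^ 2 ∂μ with hvW
  have hvar : ∀ ε : ℝ, ε ^ 2 = 1 → Var[fun ω ↦ L ε (X 0 ω, Y 0 ω); μ] = vX + vW := by
    intro ε hε
    have hm : Measurable fun ω ↦ L ε (X 0 ω, Y 0 ω) :=
      (L ε).continuous.measurable.comp (hZm 0)
    rw [variance_of_integral_eq_zero hm.aemeasurable (h0 ε 0)]
    have hcross : Integrable (fun ω ↦ 2 * ε * (X 0 ω i * W 0 ω)) μ :=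
      ((hLX i).integrable_mul hLW).const_mul _
    have hpt : ∀ ω, L ε (X 0 ω, Y 0 ω) ^ 2
        = X 0 ω i ^ 2 + W 0 ω ^ 2 + 2 * ε * (X 0 ω i * W 0 ω) := by
      intro ω
      rw [hLapp]
      linear_combination (W 0 ω) ^ 2 * hε
    have hsq : Integrable (fun ω ↦ X 0 ω i ^ 2 + W 0 ω ^ 2) μ :=
      (hLX i).integrable_sq.add hLW.integrable_sq
    simp only [hpt]
    rw [integral_add hsq hcross, integral_add (hLX i).integrable_sq hLW.integrable_sq,
      integral_const_mul, integral_mul_residual_eq_zero hLX hLY hΘ, mul_zero, add_zero]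
  have hV : vX + vW ≤ opNorm (secondMoment (X 0) μ) + opNorm (secondMoment (Y 0) μ) := by
    have h1 := diag_le_opNorm (secondMoment (X 0) μ) i
    have h2 := diag_le_opNorm (secondMoment (Y 0) μ) j
    have h3 := integral_residual_sq_le hLX hLY hΘ j
    simp only [secondMoment, Matrix.of_apply, ← sq] at h1 h2
    exact add_le_add h1 (h3.trans h2)
  have htail : ∀ ε : ℝ, ε ^ 2 = 1 → _ := fun ε hε ↦
    empirical_variance_tail hZ hZm hst (L ε) (h0 ε) ((hvar ε hε).le.trans hV) hT hM hMV hu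
  have hp := htail 1 (by norm_num)
  have hn := htail (-1) (by norm_num)
  rw [hvar 1 (by norm_num)] at hp
  rw [hvar (-1) (by norm_num)] at hn
  simp only [hLapp] at hp hn
  refine (measureReal_mono (fun ω hω ↦ ?_)).trans ((measureReal_union_le _ _).trans
    ((add_le_add hp hn).trans (by linarith)))
  by_contra hcon
  simp only [Set.mem_union, Set.mem_ofPred_eq, not_or, not_le] at hcon hω
  refine absurd hω (not_lt.2 ?_)
  rw [transpose_mul_residual_apply]
  obtain ⟨h1, h2⟩ := hcon
  rw [abs_lt] at h1 h2
  have hpol : 1 / (T : ℝ) * ∑ t : Fin T, dataMatrix X T ω t i *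
      (dataMatrix Y T ω t j - (Θᵀ *ᵥ dataMatrix X T ω t) j)
      = (1 / (T : ℝ) * ∑ t : Fin T, (X t ω i + 1 * W t ω) ^ 2
        - 1 / (T : ℝ) * ∑ t : Fin T, (X t ω i + -1 * W t ω) ^ 2) / 4 := by
    rw [← mul_sub, ← Finset.sum_sub_distrib, mul_div_assoc, Finset.sum_div]
    congr 1
    refine Finset.sum_congr rfl fun t _ ↦ ?_
    have : dataMatrix X T ω t i * (dataMatrix Y T ω t j - (Θᵀ *ᵥ dataMatrix X T ω t) j)
      = X t ω i * W t ω := rfl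
    rw [this]
    ring
  rw [hpol, abs_le]
  constructor <;> linarith

end Score

/-- Rescaling `η` inside the exponent `min(·, ·²)` costs a constant factor. -/
lemma min_mul_min_one_sq_le {a η : ℝ} (ha : 0 ≤ a) (hη : 0 ≤ η) :
    min a (a ^ 2) * min 1 (η ^ 2) ≤ min (a * η) ((a * η) ^ 2) := by
  have hm0 : 0 ≤ min 1 (η ^ 2) := le_min zero_le_one (sq_nonneg _)
  have hm1 : min 1 (η ^ 2) ≤ η := by
    rcases le_total 1 η with h | h
    · exact (min_le_left _ _).trans h
    · exact (min_le_right _ _).trans (by nlinarith)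
  refine le_min ?_ ?_
  · exact mul_le_mul (min_le_left _ _) hm1 hm0 ha
  · rw [mul_pow]
    exact mul_le_mul (min_le_right _ _) (min_le_right _ _) hm0 (sq_nonneg _)

/-- The union bound over the entries of the score. For `u ≤ 1` the tail is Gaussian; for `u ≥ 1` it
is only exponential, and the sample size condition gives `32 L ≤ T`. -/
lemma exp_mul_score_bound_le {a b ct L T : ℝ} (hb : 0 < b) (hct : 0 < ct)
    (hct1 : ct ≤ a ^ 2 / 16) (hct2 : ct ≤ 1 / 1024) (hL : 0 ≤ L) (hT : 0 < T)
    (hLT : L * √((b + 1) / ct) ≤ T) {u : ℝ} (hu0 : 0 ≤ u)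
    (hu : u = a * √((b + 1) / ct) * √(L / T)) :
    Real.exp L * Real.exp (-(T * min u (u ^ 2) / 16))
      ≤ Real.exp (-(b * L)) + Real.exp (-(T / 32)) := by
  have hA2 : √((b + 1) / ct) ^ 2 = (b + 1) / ct := Real.sq_sqrt (by positivity)
  rw [← Real.exp_add]
  rcases le_total u 1 with h | h
  · have h1 : min u (u ^ 2) = u ^ 2 := min_eq_right (by nlinarith)
    have h2 : T * u ^ 2 = a ^ 2 / ct * (b + 1) * L := by
      rw [hu, mul_pow, mul_pow, hA2, Real.sq_sqrt (by positivity)]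
      field_simp
    have h3 : 16 ≤ a ^ 2 / ct := by rw [le_div_iff₀ hct]; linarith
    have h4 : 16 * ((b + 1) * L) ≤ a ^ 2 / ct * ((b + 1) * L) := by gcongr
    have : L + -(T * min u (u ^ 2) / 16) ≤ -(b * L) := by
      rw [h1, h2]; nlinarith
    exact (Real.exp_le_exp.2 this).trans (le_add_of_nonneg_right (Real.exp_pos _).le)
  · have h1 : 1 ≤ min u (u ^ 2) := le_min h (by nlinarith)
    have h2 : 32 ≤ √((b + 1) / ct) := by
      apply Real.le_sqrt_of_sq_le
      rw [le_div_iff₀ hct]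
      linarith
    have h3 : L * 32 ≤ T := (mul_le_mul_of_nonneg_left h2 hL).trans hLT
    have h4 : T * 1 ≤ T * min u (u ^ 2) := by gcongr
    have : L + -(T * min u (u ^ 2) / 16) ≤ -(T / 32) := by linarith
    exact (Real.exp_le_exp.2 this).trans (le_add_of_nonneg_left (Real.exp_pos _).le)

/-! ### High-probability events -/

lemma measurable_dotProduct_empCov_sub {p T : ℕ} {X : ℕ → Ω → Fin p → ℝ}
    (hXm : ∀ t, Measurable (X t)) (Sig : Matrix (Fin p) (Fin p) ℝ) (v : Fin p → ℝ) :
    Measurable fun ω ↦ v ⬝ᵥ (empCov (dataMatrix X T ω) - Sig) *ᵥ v := by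
  simp only [Matrix.sub_mulVec, dotProduct_sub, dotProduct_empCov_mulVec]
  have h : ∀ t i, Measurable fun ω ↦ X t ω i := fun t i ↦ measurable_pi_iff.1 (hXm t) i
  simp only [dotProduct, dataMatrix, Matrix.of_apply]
  fun_prop

lemma measurable_score {p q T : ℕ} {X : ℕ → Ω → Fin p → ℝ} {Y : ℕ → Ω → Fin q → ℝ}
    (hXm : ∀ t, Measurable (X t)) (hYm : ∀ t, Measurable (Y t)) (Θ : Matrix (Fin p) (Fin q) ℝ)
    (i : Fin p) (j : Fin q) :
    Measurable fun ω ↦ 1 / (T : ℝ) * ((dataMatrix X T ω)ᵀ *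
        (dataMatrix Y T ω - dataMatrix X T ω * Θ)) i j := by
  have h : ∀ t i, Measurable fun ω ↦ X t ω i := fun t i ↦ measurable_pi_iff.1 (hXm t) i
  have h' : ∀ t j, Measurable fun ω ↦ Y t ω j := fun t j ↦ measurable_pi_iff.1 (hYm t) j
  simp only [transpose_mul_residual_apply, Matrix.mulVec, dotProduct, dataMatrix, Matrix.of_apply]
  fun_prop

/-- A union bound: an event cut out by finitely many conditions, each failing with probability at
most `r`. -/
lemma measureReal_forall_compl_le {κ : Type*} (F : Finset κ) (P : κ → Ω → Prop) {r : ℝ}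
    (h : ∀ v ∈ F, μ.real {ω | ¬ P v ω} ≤ r) : μ.real {ω | ∀ v ∈ F, P v ω}ᶜ ≤ F.card * r := by
  have hset : {ω | ∀ v ∈ F, P v ω}ᶜ = ⋃ v ∈ F, {ω | ¬ P v ω} := by
    ext ω; simp
  rw [hset]
  calc _ ≤ ∑ v ∈ F, μ.real {ω | ¬ P v ω} := measureReal_biUnion_finset_le _ _
    _ ≤ ∑ _v ∈ F, r := Finset.sum_le_sum h
    _ = F.card * r := by simp

lemma maxColSq_nonneg {m n : ℕ} (M : Matrix (Fin m) (Fin n) ℝ) : 0 ≤ maxColSq M :=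
  Real.iSup_nonneg fun _ ↦ Finset.sum_nonneg fun _ _ ↦ sq_nonneg _

/-- The factor by which `η` is multiplied to give the level `ε` of the tail bound at which the
empirical covariance deviates, in a unit direction, by `λ_min / 4`. -/
noncomputable def accuracyScale : ℝ := 27 / 2 * Real.pi * orthantConst

/-- The restricted eigenvalue condition fails with probability at most
`2 exp (-covRate T min(1, η²))`. -/
noncomputable def covRate : ℝ := min accuracyScale (accuracyScale ^ 2) / 32

/-- The constant `c` of the theorem: small enough that the failure probability of either event is
at most of order `exp (-2 c T min(1, η²))`, and that the sample size condition allows a union bound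
over sums of `32 s + 2` signed basis vectors. -/
noncomputable def constC : ℝ := min (covRate / 2) (1 / 64)

/-- The constant `c̃` of the theorem: the first term makes the Gaussian part of the score tail beat
`exp (-(b + 1) log (pq))`, the second makes the sample size exceed `32 log (pq)`. -/
noncomputable def constCt : ℝ := min ((8 * Real.pi * orthantConst) ^ 2 / 16) (1 / 1024)

lemma accuracyScale_pos : 0 < accuracyScale := by
  have := orthantConst_pos
  have := Real.pi_pos
  unfold accuracyScale
  positivity

lemma covRate_pos : 0 < covRate := by
  have := accuracyScale_pos
  unfold covRate
  have : 0 < min accuracyScale (accuracyScale ^ 2) := lt_min this (by positivity)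
  positivity

lemma constC_pos : 0 < constC := lt_min (by have := covRate_pos; positivity) (by norm_num)

lemma constCt_pos : 0 < constCt := by
  have := orthantConst_pos
  have := Real.pi_pos
  exact lt_min (by positivity) (by norm_num)

section Events

variable {p q : ℕ} {X : ℕ → Ω → Fin p → ℝ} {Y : ℕ → Ω → Fin q → ℝ}

lemma lambdaMin_le_diag {M : Matrix (Fin p) (Fin p) ℝ} (hM : M.IsHermitian) (i : Fin p) :
    lambdaMin M ≤ M i i := by
  simpa using lambdaMin_mul_le hM (Pi.single i 1)

lemma diag_le_lambdaMax {M : Matrix (Fin p) (Fin p) ℝ} (hM : M.IsHermitian) (i : Fin p) :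
    M i i ≤ lambdaMax M := by
  simpa using le_lambdaMax_mul hM (Pi.single i 1)

/-- The restricted eigenvalue condition holds with high probability: the empirical covariance is
accurate to within `λ_min / 4` on all sums of `32 s + 2` signed basis vectors. -/
theorem restricted_eigenvalue_event (hZ : IsGaussianProcess (fun t ω ↦ (X t ω, Y t ω)) μ)
    (hXm : ∀ t, Measurable (X t)) (hYm : ∀ t, Measurable (Y t))
    (hst : StrictlyStationary (fun t ω ↦ (X t ω, Y t ω)) μ)
    (hX0 : ∀ t i, ∫ ω, X t ω i ∂μ = 0) (hY0 : ∀ t j, ∫ ω, Y t ω j ∂μ = 0)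
    {T s : ℕ} (hp : 1 ≤ p) (hT : 0 < T) (hlmin : 0 < lambdaMin (secondMoment (X 0) μ))
    {η : ℝ} (hη : η = eta (secondMoment (X 0) μ) (alphaSum (fun t ω ↦ (X t ω, Y t ω)) μ T))
    (hS : 0 < alphaSum (fun t ω ↦ (X t ω, Y t ω)) μ T)
    (hsize : 2 ≤ p → (32 * s + 2 : ℝ) * Real.log (2 * p) ≤ covRate * T * min 1 (η ^ 2)) :
    ∃ G : Set Ω, MeasurableSet G ∧
      μ.real Gᶜ ≤ 2 * Real.exp (-(covRate * T * min 1 (η ^ 2))) ∧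
      ∀ ω ∈ G, ∀ Δ : Matrix (Fin p) (Fin q) ℝ, vecL1 Δ ^ 2 ≤ 16 * s * frob Δ ^ 2 →
        lambdaMin (secondMoment (X 0) μ) / 2 * frob Δ ^ 2
          ≤ 1 / (T : ℝ) * frob (dataMatrix X T ω * Δ) ^ 2 := by
  have hSig := secondMoment_isHermitian (μ := μ) (X 0)
  have hκ := orthantConst_pos
  have hπ := Real.pi_pos
  have hT' : (0 : ℝ) < T := by exact_mod_cast hT
  have hlmax : 0 < lambdaMax (secondMoment (X 0) μ) :=
    hlmin.trans_le ((lambdaMin_le_diag hSig ⟨0, hp⟩).trans (diag_le_lambdaMax hSig _))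
  have hηpos : 0 < η := by rw [hη, eta]; positivity
  set y := covRate * T * min 1 (η ^ 2) with hy
  have hy0 : 0 ≤ y :=
    mul_nonneg (mul_nonneg covRate_pos.le hT'.le) (le_min zero_le_one (sq_nonneg _))
  obtain ⟨F, hFcard, hF⟩ := exists_test_vectors hp (32 * s + 2) hy0 (by push_cast; exact hsize)
  set δ := lambdaMin (secondMoment (X 0) μ) / 4 with hδ
  have hδpos : 0 < δ := by positivity
  set ε := accuracyScale * η with hε
  have hεpos : 0 < ε := mul_pos accuracyScale_pos hηpos
  have hδε : 2 * lambdaMax (secondMoment (X 0) μ)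
      * alphaSum (fun t ω ↦ (X t ω, Y t ω)) μ T * ε ≤ orthantConst * δ := by
    rw [hε, hδ, hη, eta, accuracyScale]
    apply le_of_eq
    field_simp
    norm_num
  refine ⟨{ω | ∀ v ∈ F, |v ⬝ᵥ (empCov (dataMatrix X T ω) - secondMoment (X 0) μ) *ᵥ v|
    ≤ δ * (v ⬝ᵥ v)}, ?_, ?_, fun ω hω Δ hΔ ↦ ?_⟩
  · simp only [Set.ofPred_forall]
    exact Finset.measurableSet_biInter _ fun v _ ↦
      measurableSet_le (measurable_dotProduct_empCov_sub hXm _ v).abs measurable_const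
  · refine (measureReal_forall_compl_le F _ fun v _ ↦
      empCov_quadratic_tail hZ hXm hYm hst hX0 hY0 hT hδpos hεpos hδε v).trans ?_
    have h1 : y / T * 32 ≤ min ε (ε ^ 2) := by
      refine le_trans (le_of_eq ?_) (min_mul_min_one_sq_le accuracyScale_pos.le hηpos.le)
      rw [hy, covRate]; field_simp
    have h2 : 2 * y ≤ T * min ε (ε ^ 2) / 16 := by
      have := mul_le_mul_of_nonneg_left h1 hT'.le
      have h3 : T * (y / T * 32) = 32 * y := by field_simp
      linarith
    calc (F.card : ℝ) * (2 * Real.exp (-(T * min ε (ε ^ 2) / 16)))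
        ≤ Real.exp y * (2 * Real.exp (-(2 * y))) := by gcongr
      _ = 2 * Real.exp (-y) := by
          rw [mul_left_comm, ← Real.exp_add]; congr 2; ring
  · exact restricted_eigenvalue hSig hδpos.le (by rw [hδ]; linarith) (lambdaMin_mul_le hSig)
      (by omega) (by omega) (hF _ δ hω) Δ hΔ

/-- With high probability the penalty dominates the score in the maximum norm. -/
theorem score_event (hZ : IsGaussianProcess (fun t ω ↦ (X t ω, Y t ω)) μ)
    (hXm : ∀ t, Measurable (X t)) (hYm : ∀ t, Measurable (Y t))
    (hst : StrictlyStationary (fun t ω ↦ (X t ω, Y t ω)) μ)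
    (hX0 : ∀ t i, ∫ ω, X t ω i ∂μ = 0) (hY0 : ∀ t j, ∫ ω, Y t ω j ∂μ = 0)
    {Θ : Matrix (Fin p) (Fin q) ℝ}
    (hΘ : IsMinOn (populationRisk (X 0) (Y 0) μ) Set.univ Θ)
    {T : ℕ} {b lam : ℝ} (hp : 1 ≤ p) (hT : 0 < T) (hb : 0 < b)
    (hlmin : 0 < lambdaMin (secondMoment (X 0) μ))
    (hS : 0 < alphaSum (fun t ω ↦ (X t ω, Y t ω)) μ T)
    (hL : 0 < Real.log ((p : ℝ) * q))
    (hlam : lam = 4 * multiplierQ b constCt (secondMoment (X 0) μ) (secondMoment (Y 0) μ) Θ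
      * rateR p q T (alphaSum (fun t ω ↦ (X t ω, Y t ω)) μ T))
    (hsize : Real.log ((p : ℝ) * q) * √((b + 1) / constCt) ≤ T) :
    0 < lam ∧ ∃ G : Set Ω, MeasurableSet G ∧
      μ.real Gᶜ ≤ 4 * Real.exp (-(b * Real.log ((p : ℝ) * q))) + 4 * Real.exp (-(T / 32 : ℝ)) ∧
      ∀ ω ∈ G, ∀ i j, |1 / (T : ℝ) * ((dataMatrix X T ω)ᵀ *
        (dataMatrix Y T ω - dataMatrix X T ω * Θ)) i j| ≤ lam / 4 := by
  have hκ := orthantConst_pos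
  have hπ := Real.pi_pos
  have hct := constCt_pos
  have hT' : (0 : ℝ) < T := by exact_mod_cast hT
  have hpq : (0 : ℝ) < p * q := by
    refine lt_of_le_of_ne (by positivity) fun h ↦ ?_
    rw [← h, Real.log_zero] at hL
    exact lt_irrefl _ hL
  set S := alphaSum (fun t ω ↦ (X t ω, Y t ω)) μ T
  set L := Real.log ((p : ℝ) * q) with hLdef
  have hopX : 0 < opNorm (secondMoment (X 0) μ) :=
    hlmin.trans_le ((lambdaMin_le_diag (secondMoment_isHermitian _) ⟨0, hp⟩).trans
      (diag_le_opNorm _ _))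
  have hopY := opNorm_nonneg (secondMoment (Y 0) μ)
  set u := 8 * Real.pi * orthantConst * √((b + 1) / constCt) * √(L / T) with hu
  have hupos : 0 < u := by positivity
  set M := 2 * (opNorm (secondMoment (X 0) μ) + opNorm (secondMoment (Y 0) μ)) * S / orthantConst
    with hM
  have hMpos : 0 < M := by positivity
  have hlamu : M * u / 2 ≤ lam / 4 := by
    have h1 : M * u / 2 = 8 * Real.pi * √((b + 1) / constCt) *
        (opNorm (secondMoment (X 0) μ) + opNorm (secondMoment (Y 0) μ)) * (S * √(L / T)) := by
      rw [hM, hu]; field_simp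
    have h2 : lam / 4 = 8 * Real.pi * √((b + 1) / constCt)
        * (opNorm (secondMoment (X 0) μ) * (1 + maxColSq Θ) + opNorm (secondMoment (Y 0) μ))
        * (S * √(L / T)) := by
      rw [hlam, multiplierQ, rateR]; ring
    rw [h1, h2]
    gcongr
    nlinarith [mul_nonneg hopX.le (maxColSq_nonneg Θ)]
  have hMu : 0 < M * u / 2 := by positivity
  refine ⟨by linarith, {ω | ∀ ij ∈ (Finset.univ : Finset (Fin p × Fin q)),
    |1 / (T : ℝ) * ((dataMatrix X T ω)ᵀ *
      (dataMatrix Y T ω - dataMatrix X T ω * Θ)) ij.1 ij.2| ≤ M * u / 2}, ?_, ?_,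
    fun ω hω i j ↦ (hω (i, j) (Finset.mem_univ _)).trans hlamu⟩
  · simp only [Set.ofPred_forall]
    exact Finset.measurableSet_biInter _ fun ij _ ↦
      measurableSet_le (measurable_score hXm hYm Θ ij.1 ij.2).abs measurable_const
  · refine (measureReal_forall_compl_le _ _ fun ij _ ↦
      score_tail hZ hXm hYm hst hX0 hY0 hΘ hT hMpos hupos.le (by
        rw [hM, mul_div_cancel₀ _ hκ.ne']) ij.1 ij.2).trans ?_
    have hcard : ((Finset.univ : Finset (Fin p × Fin q)).card : ℝ) = Real.exp L := by
      rw [hLdef, Real.exp_log hpq]; simp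
    rw [hcard]
    have h1 := exp_mul_score_bound_le hb hct (min_le_left _ _) (min_le_right _ _) hL.le hT'
      hsize hupos.le hu
    linarith

/-- The sample size condition pays for the union bound over the test vectors. -/
lemma test_vectors_size {T s : ℕ} {m : ℝ} (hm : 0 < m) (hp : 2 ≤ p)
    (hsize : Real.log p / (constC * m) * max (42 * Real.exp 1) (128 * s) ≤ T) :
    (32 * s + 2 : ℝ) * Real.log (2 * p) ≤ covRate * T * m := by
  have hc := constC_pos
  have hp0 : (0 : ℝ) < p := by exact_mod_cast (by omega : 0 < p)
  have hlog2 : Real.log 2 ≤ Real.log p :=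
    Real.log_le_log (by norm_num) (by exact_mod_cast hp)
  have hlog0 : 0 < Real.log 2 := Real.log_pos (by norm_num)
  have hnum : (64 * s + 4 : ℝ) ≤ max (42 * Real.exp 1) (128 * s) := by
    rcases Nat.eq_zero_or_pos s with h | h
    · refine le_max_of_le_left ?_
      have := Real.add_one_le_exp (1 : ℝ)
      simp only [h, Nat.cast_zero]
      linarith
    · refine le_max_of_le_right ?_
      have : (1 : ℝ) ≤ s := by exact_mod_cast h
      linarith
  rw [div_mul_eq_mul_div, div_le_iff₀ (by positivity)] at hsize
  have h1 : constC ≤ covRate := (min_le_left _ _).trans (by linarith [covRate_pos])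
  rw [Real.log_mul two_ne_zero hp0.ne']
  calc (32 * (s : ℝ) + 2) * (Real.log 2 + Real.log p)
      ≤ (32 * (s : ℝ) + 2) * (Real.log p + Real.log p) := by gcongr
    _ = Real.log p * (64 * s + 4) := by ring
    _ ≤ Real.log p * max (42 * Real.exp 1) (128 * s) := by
        gcongr
    _ ≤ T * (constC * m) := hsize
    _ ≤ T * (covRate * m) := by gcongr
    _ = covRate * T * m := by ring

end Events

end MixingLasso

open MixingLasso in
theorem mainTheorem2 :
    ∃ c : ℝ, 0 < c ∧ ∃ ct : ℝ, 0 < ct ∧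
      ∀ (Ω : Type*) [MeasurableSpace Ω] (μ : Measure Ω) [IsProbabilityMeasure μ]
        (p q T s : ℕ) (b : ℝ)
        (X : ℕ → Ω → Fin p → ℝ) (Y : ℕ → Ω → Fin q → ℝ)
        (SigX : Matrix (Fin p) (Fin p) ℝ) (SigY : Matrix (Fin q) (Fin q) ℝ)
        (Θ : Matrix (Fin p) (Fin q) ℝ) (S η lam α : ℝ),
        0 < b →
        (∀ t, Measurable (X t)) → (∀ t, Measurable (Y t)) →
        -- strictly stationary, centered, Gaussian, α-mixing
        MixingLasso.StrictlyStationary (fun t ω => (X t ω, Y t ω)) μ →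
        (∀ t i, ∫ ω, X t ω i ∂μ = 0) → (∀ t j, ∫ ω, Y t ω j ∂μ = 0) →
        IsGaussianProcess (fun t ω => (X t ω, Y t ω)) μ →
        MixingLasso.AlphaMixing (fun t ω => (X t ω, Y t ω)) μ →
        -- covariance matrices, with `Σ_X` nonsingular
        SigX = MixingLasso.secondMoment (X 0) μ →
        SigY = MixingLasso.secondMoment (Y 0) μ →
        0 < MixingLasso.lambdaMin SigX →
        -- the target is the population least squares matrix, and it is `s`-sparse
        IsMinOn (MixingLasso.populationRisk (X 0) (Y 0) μ) Set.univ Θ →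
        MixingLasso.sparsity Θ = s →
        -- the constants
        S = MixingLasso.alphaSum (fun t ω => (X t ω, Y t ω)) μ T →
        η = MixingLasso.eta SigX S →
        lam = 4 * MixingLasso.multiplierQ b ct SigX SigY Θ * MixingLasso.rateR p q T S →
        α = MixingLasso.lambdaMin SigX / 2 →
        -- the sample size condition
        max (Real.log p / (c * min 1 (η ^ 2)) * max (42 * Real.exp 1) (128 * s))
            (Real.log ((p : ℝ) * q) * √((b + 1) / ct)) ≤ T →
        ∃ G : Set Ω, MeasurableSet G ∧
          1 - 2 * Real.exp (-(c / 2) * T * min 1 (η ^ 2))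
              - 8 * Real.exp (-b * Real.log ((p : ℝ) * q)) ≤ μ.real G ∧
          ∀ ω ∈ G, ∀ Θhat : Matrix (Fin p) (Fin q) ℝ,
            MixingLasso.IsLasso (MixingLasso.dataMatrix X T ω) (MixingLasso.dataMatrix Y T ω)
              lam Θhat →
            -- estimation error
            MixingLasso.frob (Θhat - Θ) ≤ 4 * √s * lam / α ∧
            -- in-sample prediction error
            1 / (T : ℝ) * MixingLasso.frob (MixingLasso.dataMatrix X T ω * (Θhat - Θ)) ^ 2
              ≤ 32 * lam ^ 2 * s / α ∧
            MixingLasso.frob ((Θhat - Θ)ᵀ * MixingLasso.empCov (MixingLasso.dataMatrix X T ω)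
              * (Θhat - Θ)) ≤ 32 * lam ^ 2 * s / α := by
  refine ⟨constC, constC_pos, constCt, constCt_pos, ?_⟩
  intro Ω mΩ μ hμ p q T s b X Y SigX SigY Θ S η lam α hb hXm hYm hst hX0 hY0 hZ _ hSigX hSigY
    hlmin hΘ hs hS hη hlam hα hsize
  have hm0 : 0 ≤ min 1 (η ^ 2) := le_min zero_le_one (sq_nonneg _)
  have hexp1 : -(constC / 2) * T * min 1 (η ^ 2) = -(constC / 2 * T * min 1 (η ^ 2)) := by ring
  rw [hexp1, neg_mul]
  set x := constC / 2 * T * min 1 (η ^ 2) with hx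
  -- unless the announced probability is positive, the empty event will do
  by_cases hxbig : 1 ≤ 2 * Real.exp (-x)
  · refine ⟨∅, .empty, ?_, by simp⟩
    rw [measureReal_empty]
    have := Real.exp_pos (-(b * Real.log ((p : ℝ) * q)))
    linarith
  by_cases hL : Real.log ((p : ℝ) * q) ≤ 0
  · refine ⟨∅, .empty, ?_, by simp⟩
    rw [measureReal_empty]
    have h1 : 1 ≤ Real.exp (-(b * Real.log ((p : ℝ) * q))) := Real.one_le_exp (by nlinarith)
    have := Real.exp_pos (-x)
    linarith
  push Not at hxbig hL
  have hxpos : 0 < x := by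
    by_contra h
    have : 1 ≤ Real.exp (-x) := Real.one_le_exp (by linarith)
    linarith
  have hT : 0 < T := Nat.pos_of_ne_zero fun h ↦ by simp [hx, h] at hxpos
  have hT' : (0 : ℝ) < T := by exact_mod_cast hT
  have hm : 0 < min 1 (η ^ 2) := hm0.lt_of_ne' fun h ↦ by simp [hx, h] at hxpos
  have hp : 1 ≤ p := Nat.one_le_iff_ne_zero.2 fun h ↦ by simp [h] at hL
  have hSpos : 0 < S := (hS ▸ alphaSum_nonneg T : 0 ≤ S).lt_of_ne' fun h ↦ by
    have : η = 0 := by rw [hη, eta, h]; simp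
    simp [this] at hm
  subst hSigX hSigY hS
  obtain ⟨hsize1, hsize2⟩ := max_le_iff.1 hsize
  obtain ⟨G₁, hG₁m, hP₁, hG₁⟩ := restricted_eigenvalue_event hZ hXm hYm hst hX0 hY0 (s := s) hp hT
    hlmin hη hSpos fun hp2 ↦ test_vectors_size hm hp2 hsize1
  obtain ⟨hlampos, G₂, hG₂m, hP₂, hG₂⟩ := score_event hZ hXm hYm hst hX0 hY0 hΘ hp hT hb hlmin
    hSpos hL hlam hsize2
  refine ⟨G₁ ∩ G₂, hG₁m.inter hG₂m, ?_, ?_⟩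
  · -- both exceptional probabilities are governed by `exp (-4 x) ≤ exp (-x) / 8`
    have hxy : Real.exp (-(covRate * T * min 1 (η ^ 2))) ≤ Real.exp (-(4 * x)) := by
      apply Real.exp_le_exp.2
      have h1 : constC ≤ covRate / 2 := min_le_left _ _
      have h2 := mul_le_mul_of_nonneg_right h1 (mul_nonneg hT'.le hm0)
      rw [hx]; linarith
    have hxT : Real.exp (-(T / 32 : ℝ)) ≤ Real.exp (-(4 * x)) := by
      apply Real.exp_le_exp.2
      have h1 : constC ≤ 1 / 64 := min_le_right _ _
      have h2 : constC * (T * min 1 (η ^ 2)) ≤ 1 / 64 * (T * 1) := by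
        gcongr; exact min_le_left _ _
      rw [hx]; linarith
    have h1 := probReal_add_probReal_compl (μ := μ) (hG₁m.inter hG₂m)
    have h2 : μ.real (G₁ ∩ G₂)ᶜ ≤ μ.real G₁ᶜ + μ.real G₂ᶜ := by
      rw [Set.compl_inter]; exact measureReal_union_le _ _
    have h8 := Real.exp_pos (-x)
    have h3 : Real.exp (-(4 * x)) ≤ Real.exp (-x) / 8 := by
      have h4 : Real.exp (-(4 * x)) = Real.exp (-x) ^ 4 := by
        rw [← Real.exp_nat_mul]; congr 1; push_cast; ring
      have h6 : Real.exp (-x) ^ 3 ≤ (1 / 2) ^ 3 := by gcongr; linarith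
      rw [h4]
      nlinarith
    have h7 := Real.exp_pos (-(b * Real.log ((p : ℝ) * q)))
    linarith
  · rintro ω ⟨hω₁, hω₂⟩ Θhat hlasso
    exact lasso_bounds hlampos (by rw [hα]; positivity) hs (hG₂ ω hω₂)
      (by rw [hα]; exact hG₁ ω hω₁) hlasso
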